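/- There are absolute constants $C,K,c>0$ and $R\in\mathbb{N}$ such that the following holds. Let $G=(V,E,w)$ be an undirected weighted graph with $n$ nodes, without self-loops and with nonnegative weights, in which every degree $d_u=\sum_{v}w(u,v)$ is positive. For $S\subseteq V$ let $\operatorname{vol}_G(S)=\sum_{u\in S}d_u$ and $\phi_G(S)=w(S,V\setminus S)/\operatorname{vol}_G(S)$. Let $\rho_G(k)$ be the minimum of $\max_i\phi_G(A_i)$ over all partitions of $V$ into $k$ nonempty sets $A_1,\dots,A_k$, let $\lambda_1\le\dots\le\lambda_n$ be the eigenvalues of the normalised Laplacian $I-D^{-1/2}AD^{-1/2}$ of $G$, and let $\Upsilon_G(k)=\lambda_{k+1}/\rho_G(k)$ (which is $\infty$ if $\rho_G(k)=0<\lambda_{k+1}$). Let $1\le k<n$ with $\lambda_{k+1}>0$, let $S_1,\dots,S_k$ be a partition that attains $\rho_G(k)$ (the optimal clusters), and let $\tau\ge C/\lambda_{k+1}$. Let $p_u(v)=\min\{w(u,v)\,\tau\log n/d_u,\,1\}$ and $p_e=p_u(v)+p_v(u)-p_u(v)p_v(u)$ for $e=\{u,v\}\in E$. Every node $u$ samples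 each incident edge $\{u,v\}$ with probability $p_u(v)$, all choices being independent, and $H=(V,F,w_H)$ consists of the edges that were sampled by at least one endpoint, with weight $w_H(e)=w(e)/p_e$. Thus $F\subseteq E$, and each edge $e$ is kept independently of the others with probability $p_e$. There is a synchronous distributed algorithm, in which every node of $G$ is a computational unit that initially knows $n$, $\tau$, the weights of its incident edges and its own random choices and that communicates only with its neighbours, such that after $R$ rounds every node knows its incident edges in $H$ and their weights. With probability greater than $0.99$ all of the following hold: (a) $|F|\le K\,n\tau\log n$; (b) the total number of words sent by the distributed algorithm is at most $K\,n\tau\log n$, where a word holds one number; (c) every degree in $H$ is positive, and $\Upsilon_H(k)\ge c\,\Upsilon_G(k)/k$; (d) $\phi_H(S_i)\le K\,k\,\phi_G(S_i)$ for every $1\le i\le k$. -/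

import Mathlib

open MeasureTheory ProbabilityTheory
open scoped unitInterval NNReal ENNReal

universe u

noncomputable section

/-- An undirected weighted graph on the vertex set `V`, without loops: a symmetric nonnegative
weight function. The edges are the pairs of nonzero weight. -/
structure WGraph (V : Type u) where
  w : V → V → ℝ
  symm : ∀ x y, w x y = w y x
  nonneg : ∀ x y, 0 ≤ w x y
  loopless : ∀ x, w x x = 0

namespace WGraph

variable {V : Type u}

/-- The underlying simple graph; its edge set is the edge set of the weighted graph. -/
def graph (G : WGraph V) : SimpleGraph V where
  Adj x y := G.w x y ≠ 0
  symm := ⟨fun x y h => by rw [G.symm y x]; exact h⟩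
  loopless := ⟨fun x h => h (G.loopless x)⟩

variable [Fintype V]

/-- The (weighted) degree of a vertex. -/
def deg (G : WGraph V) (x : V) : ℝ := ∑ y, G.w x y

/-- The volume of a set of vertices. -/
def vol (G : WGraph V) (S : Finset V) : ℝ := ∑ x ∈ S, G.deg x

variable [DecidableEq V]

/-- The total weight of the edges between `S` and its complement. -/
def cut (G : WGraph V) (S : Finset V) : ℝ := ∑ x ∈ S, ∑ y ∈ Sᶜ, G.w x y

/-- The conductance of a set of vertices. -/
def conductance (G : WGraph V) (S : Finset V) : ℝ := G.cut S / G.vol S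

/-- `A 0, …, A (k-1)` is a partition of the vertex set into `k` nonempty sets. -/
structure IsPartition {k : ℕ} (A : Fin k → Finset V) : Prop where
  nonempty : ∀ i, (A i).Nonempty
  disjoint : ∀ i j, i ≠ j → Disjoint (A i) (A j)
  cover : ∀ x, ∃ i, x ∈ A i

/-- The `k`-way expansion constant: the minimum over all `k`-way partitions of the largest
conductance of a part. -/
def rho (G : WGraph V) (k : ℕ) : ℝ :=
  ⨅ A : {A : Fin k → Finset V // IsPartition A}, ⨆ i, G.conductance (A.1 i)

/-- A `k`-way partition that attains the `k`-way expansion constant. -/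
def IsOptimal (G : WGraph V) {k : ℕ} (S : Fin k → Finset V) : Prop :=
  IsPartition S ∧ ⨆ i, G.conductance (S i) = G.rho k

/-- The normalised Laplacian `I - D^{-1/2} A D^{-1/2}`. -/
def normLap (G : WGraph V) : Matrix V V ℝ :=
  1 - Matrix.of fun x y => G.w x y / (√(G.deg x) * √(G.deg y))

theorem normLap_isHermitian (G : WGraph V) : G.normLap.IsHermitian := by
  ext x y
  simp only [normLap, Matrix.conjTranspose_apply, Matrix.sub_apply, Matrix.of_apply, star_trivial,
    Matrix.one_apply, G.symm y x, mul_comm (√(G.deg y)), eq_comm (a := y) (b := x)]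

/-- The eigenvalues of the normalised Laplacian in increasing order, counted with multiplicity and
indexed from `0`: the eigenvalue usually written `λ_{i+1}` is `G.eig i`. -/
def eig (G : WGraph V) (i : Fin (Fintype.card V)) : ℝ :=
  G.normLap_isHermitian.eigenvalues₀ i.rev

/-- The gap `λ_{k+1} / ρ(k)`, with value `∞` if `ρ(k) = 0 < λ_{k+1}`. -/
def gap (G : WGraph V) (k : ℕ) (hk : k < Fintype.card V) : ℝ≥0∞ :=
  ENNReal.ofReal (G.eig ⟨k, hk⟩) / ENNReal.ofReal (G.rho k)

end WGraph

/-! ### The sampling scheme -/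

/-- The probability with which a node of degree `d` samples an incident edge of weight `a`, in a
graph with `n` nodes. -/
def sampleProb (n : ℕ) (τ : ℝ≥0) (a d : ℝ) : ℝ := min (a * (τ * Real.log n / d)) 1

/-- The probability that an edge of weight `a` between nodes of degrees `d` and `d'` is sampled by
at least one of its endpoints. -/
def edgeProb (n : ℕ) (τ : ℝ≥0) (a d d' : ℝ) : ℝ :=
  sampleProb n τ a d + sampleProb n τ a d' - sampleProb n τ a d * sampleProb n τ a d'

theorem edgeProb_comm (n : ℕ) (τ : ℝ≥0) (a d d' : ℝ) :
    edgeProb n τ a d d' = edgeProb n τ a d' d := by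
  unfold edgeProb; ring

theorem edgeProb_nonneg (n : ℕ) (τ : ℝ≥0) {a d d' : ℝ} (ha : 0 ≤ a) (hd : 0 ≤ d) (hd' : 0 ≤ d') :
    0 ≤ edgeProb n τ a d d' := by
  have hl : 0 ≤ Real.log n := Real.log_natCast_nonneg n
  have h1 : 0 ≤ sampleProb n τ a d := le_min (by positivity) zero_le_one
  have h2 : 0 ≤ sampleProb n τ a d' := le_min (by positivity) zero_le_one
  have h3 : sampleProb n τ a d ≤ 1 := min_le_right _ _
  unfold edgeProb
  nlinarith

namespace WGraph

variable {V : Type u} [Fintype V]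

theorem deg_nonneg (G : WGraph V) (x : V) : 0 ≤ G.deg x :=
  Finset.sum_nonneg fun y _ => G.nonneg x y

/-- Node `x` samples the edge to `y`. Every node `x` holds independent uniform random numbers
`ω x y ∈ [0,1]`. -/
def Samples (G : WGraph V) (τ : ℝ≥0) (ω : V → V → I) (x y : V) : Prop :=
  G.w x y ≠ 0 ∧ (ω x y : ℝ) ≤ sampleProb (Fintype.card V) τ (G.w x y) (G.deg x)

instance (G : WGraph V) (τ : ℝ≥0) (ω : V → V → I) (x y : V) : Decidable (G.Samples τ ω x y) :=
  inferInstanceAs (Decidable (_ ∧ _))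

/-- The random graph `H`: an edge is kept if at least one endpoint samples it, and its weight is
then divided by the probability of being kept. -/
def sparsify (G : WGraph V) (τ : ℝ≥0) (ω : V → V → I) : WGraph V where
  w x y := if G.Samples τ ω x y ∨ G.Samples τ ω y x then
    G.w x y / edgeProb (Fintype.card V) τ (G.w x y) (G.deg x) (G.deg y) else 0
  symm x y := by
    rw [G.symm y x, edgeProb_comm _ _ _ (G.deg y)]
    exact if_congr or_comm rfl rfl
  nonneg x y := by
    split_ifs
    · exact div_nonneg (G.nonneg x y)
        (edgeProb_nonneg _ _ (G.nonneg x y) (G.deg_nonneg x) (G.deg_nonneg y))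
    · exact le_rfl
  loopless x := by simp [G.loopless x]

end WGraph

/-! ### Synchronous distributed algorithms on a graph

Every node is a computational unit. It initially knows its name, the weights of its incident edges
and its private random numbers. In every round each node sends a message (a list of words, possibly
empty) to each of its neighbours, and then updates its state from the messages that it received.
A word holds one number; the empty message is free. -/

/-- A synchronous distributed algorithm on graphs with vertex set `V`, in which every node outputs
a list of edge weights. `output s = none` means that a node in state `s` has not finished. -/
structure DistAlg (V : Type u) where
  State : Type u
  init : V → (V → ℝ) → (V → I) → State
  send : State → V → List ℝ
  recv : State → (V → List ℝ) → State
  output : State → Option (V → ℝ)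

namespace DistAlg

variable {V : Type u}

/-- The message from `x` to `y` when the nodes are in the states `s`; only neighbours can
communicate. -/
def msg (A : DistAlg V) (G : WGraph V) (s : V → A.State) (x y : V) : List ℝ :=
  if G.w x y = 0 then [] else A.send (s x) y

/-- The states of all nodes after a number of rounds. -/
def exec (A : DistAlg V) (G : WGraph V) (ω : V → V → I) : ℕ → V → A.State
  | 0 => fun x => A.init x (G.w x) (ω x)
  | t + 1 => fun x => A.recv (A.exec G ω t x) fun y => A.msg G (A.exec G ω t) y x

/-- The total number of words sent by all nodes during the first `R` rounds. -/
def words [Fintype V] (A : DistAlg V) (G : WGraph V) (ω : V → V → I) (R : ℕ) : ℕ :=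
  ∑ t ∈ Finset.range R, ∑ x, ∑ y, (A.msg G (A.exec G ω t) x y).length

/-- The algorithm finishes within `R` rounds, and the output of each node `x` consists of the
weights in `H` of the pairs `{x, y}`. -/
def Computes (A : DistAlg V) (G : WGraph V) (ω : V → V → I) (R : ℕ) (H : WGraph V) : Prop :=
  ∀ x, A.output (A.exec G ω R x) = some (H.w x)

end DistAlg

/-- The local memory of a node of the sparsification algorithm: the number of rounds passed, the
weights of the incident edges, the set of edges sampled by the node, and the degrees received from
neighbours. -/
structure SparsifyState (V : Type u) where
  time : ℕ
  row : V → ℝ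
  sampled : V → Bool
  nbrDeg : V → Option ℝ

/-- The sparsification algorithm. In the first round every node sends its degree along the
incident edges that it sampled. In the second round every node sends its degree back along the
edges that were sampled by the other endpoint only. Then both endpoints of a kept edge know both
degrees, hence the new weight of that edge. -/
def sparsifyAlg (V : Type u) [Fintype V] (τ : ℝ≥0) : DistAlg V where
  State := SparsifyState V
  init _ row coin :=
    { time := 0
      row := row
      sampled := fun y =>
        decide (row y ≠ 0 ∧ (coin y : ℝ) ≤ sampleProb (Fintype.card V) τ (row y) (∑ z, row z))
      nbrDeg := fun _ => none }
  send s y :=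
    if s.time = 0 then
      if s.sampled y then [∑ z, s.row z] else []
    else if s.time = 1 then
      if !s.sampled y && (s.nbrDeg y).isSome then [∑ z, s.row z] else []
    else []
  recv s inbox :=
    { s with
      time := s.time + 1
      nbrDeg := fun y => ((inbox y).head?).or (s.nbrDeg y) }
  output s :=
    if s.time < 2 then none
    else some fun y =>
      match s.nbrDeg y with
      | none => 0
      | some d => s.row y / edgeProb (Fintype.card V) τ (s.row y) (∑ z, s.row z) d

end

/-! Five nonnegative random variables with bounded means control everything: the number of pairs
(node, edge sampled by it), with mean at most `n * τ * log n`; the sum over the clusters of the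
ratios of new to old cut, with mean at most `k`; two sums over the vertices of exponential moments,
for the upper and the lower tail of the degrees; and the trace of a random matrix exponential, the
last three with mean at most `n`. By Markov's inequality each exceeds 1000 times its bound with
probability at most 1/1000. Outside these five events the guarantees follow deterministically.

The cuts are unbiased, so the only price for treating all clusters at once is the factor `k`, which
enters the bounds on conductances and on the gap. Where an exponential moment is at most `1000 * n ≤
n ^ 11`, its exponent, which carries a factor `τ * log n`, is at most `11 * log n`; the logarithm
cancels and `τ ≥ C / λ` finishes.

For the eigenvalue only a lower bound with an additive error is needed: the energy of `H` is at
least half that of `G` minus `λ / 4` times the squared norm weighted by degrees. On the subspace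
where the energy of `G` is at least `λ` times that norm, a quarter of `λ` survives, and
Courant-Fischer carries it to `H` because degrees grow at most by a constant factor
(`eig_div_le_eig`). This is why sampling by degrees suffices.

The energy bound (`exists_exp_energy_le`) is a matrix Chernoff bound. An edge contributes a random
multiple of a rank-one projection, so Golden-Thompson is needed only for such a perturbation
(`trace_exp_add_smul_vecMulVec_le`). It follows by differentiating the trace along the perturbation
and bounding the growth of the derivative, which reduces to Chebyshev's sum inequality for powers.
-/

noncomputable section

/-! ### Orthogonal diagonalisation and functions of symmetric matrices -/

namespace Matrix

variable {ι : Type*} [Fintype ι] [DecidableEq ι]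

/-- A real symmetric matrix is orthogonally diagonalisable. -/
theorem IsHermitian.exists_orthogonal_diagonal {A : Matrix ι ι ℝ} (hA : A.IsHermitian) :
    ∃ U : Matrix ι ι ℝ, Uᵀ * U = 1 ∧ U * Uᵀ = 1 ∧ A = U * diagonal hA.eigenvalues * Uᵀ := by
  refine ⟨hA.eigenvectorUnitary, ?_, ?_, ?_⟩
  · have := Unitary.coe_star_mul_self hA.eigenvectorUnitary
    simpa [star_eq_conjTranspose, conjTranspose_eq_transpose_of_trivial] using this
  · have := Unitary.coe_mul_star_self hA.eigenvectorUnitary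
    simpa [star_eq_conjTranspose, conjTranspose_eq_transpose_of_trivial] using this
  · have := hA.spectral_theorem
    rw [Unitary.conjStarAlgAut_apply] at this
    simpa [star_eq_conjTranspose, conjTranspose_eq_transpose_of_trivial, Function.comp_def]
      using this

theorem dotProduct_conj_diagonal_mulVec (U : Matrix ι ι ℝ) (f v : ι → ℝ) :
    v ⬝ᵥ (U * diagonal f * Uᵀ) *ᵥ v = ∑ i, (Uᵀ *ᵥ v) i ^ 2 * f i := by
  rw [← mulVec_mulVec, ← mulVec_mulVec, dotProduct_mulVec, ← mulVec_transpose, dotProduct]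
  refine Finset.sum_congr rfl fun i _ => ?_
  rw [mulVec_diagonal]; ring

theorem sum_transpose_mulVec_sq {U : Matrix ι ι ℝ} (hU : U * Uᵀ = 1) (v : ι → ℝ) :
    ∑ i, (Uᵀ *ᵥ v) i ^ 2 = v ⬝ᵥ v := by
  have := dotProduct_conj_diagonal_mulVec U (fun _ => 1) v
  simpa [hU] using this.symm

theorem trace_conj_diagonal {U : Matrix ι ι ℝ} (hU : Uᵀ * U = 1) (f : ι → ℝ) :
    (U * diagonal f * Uᵀ).trace = ∑ i, f i := by
  rw [trace_mul_comm, ← mul_assoc, hU, one_mul, trace_diagonal]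

theorem conj_diagonal_mul {U : Matrix ι ι ℝ} (hU : Uᵀ * U = 1) (f g : ι → ℝ) :
    (U * diagonal f * Uᵀ) * (U * diagonal g * Uᵀ) = U * diagonal (fun i => f i * g i) * Uᵀ := by
  rw [← diagonal_mul_diagonal]
  calc _ = U * diagonal f * (Uᵀ * U) * diagonal g * Uᵀ := by simp only [mul_assoc]
    _ = _ := by rw [hU, mul_one]; simp only [mul_assoc]

theorem conj_diagonal_pow {U : Matrix ι ι ℝ} (hU : Uᵀ * U = 1) (hU' : U * Uᵀ = 1) (f : ι → ℝ)
    (m : ℕ) : (U * diagonal f * Uᵀ) ^ m = U * diagonal (fun i => f i ^ m) * Uᵀ := by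
  induction m with
  | zero => simp [hU']
  | succ m ih => rw [pow_succ, ih, conj_diagonal_mul hU]; simp only [pow_succ]

theorem exp_conj_diagonal {U : Matrix ι ι ℝ} (hU : Uᵀ * U = 1) (f : ι → ℝ) :
    NormedSpace.exp (U * diagonal f * Uᵀ) = U * diagonal (fun i => Real.exp (f i)) * Uᵀ := by
  have hi : U⁻¹ = Uᵀ := inv_eq_left_inv hU
  have hu : IsUnit U := (isUnit_iff_isUnit_det _).2 (isUnit_det_of_left_inverse hU)
  rw [← hi, exp_conj _ _ hu, exp_diagonal]
  congr 3
  ext i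
  rw [Pi.coe_exp, Real.exp_eq_exp_ℝ]

theorem conj_diagonal_add_smul_one {U : Matrix ι ι ℝ} (hU' : U * Uᵀ = 1) (f : ι → ℝ) (s : ℝ) :
    U * diagonal f * Uᵀ + s • 1 = U * diagonal (fun i => f i + s) * Uᵀ := by
  have : diagonal (fun i => f i + s) = diagonal f + s • (1 : Matrix ι ι ℝ) := by
    rw [← diagonal_add, smul_one_eq_diagonal]
  rw [this, mul_add, add_mul]
  simp [hU']

end Matrix

/-! ### The trace of the exponential under rank-one perturbations -/

/-- Chebyshev's inequality for two increasing functions with respect to a probability weight. -/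
theorem sum_mul_sum_le_of_monovary {ι : Type*} [Fintype ι] {w f g : ι → ℝ} (hw : ∀ i, 0 ≤ w i)
    (hw1 : ∑ i, w i = 1) (hfg : Monovary f g) :
    (∑ i, w i * f i) * (∑ i, w i * g i) ≤ ∑ i, w i * (f i * g i) := by
  have h : 0 ≤ ∑ i, ∑ j, w i * w j * ((f i - f j) * (g i - g j)) := by
    refine Finset.sum_nonneg fun i _ => Finset.sum_nonneg fun j _ => ?_
    refine mul_nonneg (mul_nonneg (hw i) (hw j)) ?_
    have := monovary_iff_forall_smul_nonneg.1 hfg j i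
    simpa using this
  have e : ∑ i, ∑ j, w i * w j * ((f i - f j) * (g i - g j)) =
      2 * ((∑ i, w i) * ∑ i, w i * (f i * g i)) - 2 * ((∑ i, w i * f i) * ∑ i, w i * g i) := by
    have e1 : ∀ i j, w i * w j * ((f i - f j) * (g i - g j)) =
      w i * (f i * g i) * w j + w i * (w j * (f j * g j)) -
        (w i * f i) * (w j * g j) - (w i * g i) * (w j * f j) := fun i j => by ring
    simp only [e1, Finset.sum_sub_distrib, Finset.sum_add_distrib, ← Finset.mul_sum,
      ← Finset.sum_mul]
    ring
  rw [e, hw1] at h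
  linarith

namespace Matrix

variable {ι : Type*} [Fintype ι] [DecidableEq ι]

/-- The right side is what results if the projection `vecMulVec v v` is replaced by the identity.
Splitting off one factor of the power leaves a term with the projection, which factors as `(v ⬝ᵥ A ^
m *ᵥ v) * (v ⬝ᵥ X *ᵥ v)`. Both factors are means over the spectral weights of `v`, the second after
the induction hypothesis for exponent 0, and Chebyshev's inequality bounds their product by one
mean. The extra power `A ^ m` makes the induction close. -/
theorem dotProduct_pow_mul_pow_add_vecMulVec_le {U : Matrix ι ι ℝ} (hU : Uᵀ * U = 1)
    (hU' : U * Uᵀ = 1) {f : ι → ℝ} (hf : ∀ i, 0 ≤ f i) {v : ι → ℝ} (hv : v ⬝ᵥ v = 1) {s : ℝ}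
    (hs : 0 ≤ s) (k : ℕ) : ∀ m : ℕ,
    v ⬝ᵥ ((U * diagonal f * Uᵀ) ^ m * (U * diagonal f * Uᵀ + s • vecMulVec v v) ^ k) *ᵥ v ≤
      ∑ i, (Uᵀ *ᵥ v) i ^ 2 * (f i ^ m * (f i + s) ^ k) := by
  induction k with
  | zero =>
    intro m
    rw [pow_zero, mul_one, conj_diagonal_pow hU hU', dotProduct_conj_diagonal_mulVec]
    simp
  | succ k ih =>
    intro m
    set A := U * diagonal f * Uᵀ with hA
    set X := (A + s • vecMulVec v v) ^ k with hX
    have e : A ^ m * (A + s • vecMulVec v v) ^ (k + 1) =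
        A ^ (m + 1) * X + s • (A ^ m * (vecMulVec v v * X)) := by
      rw [pow_succ', pow_succ]
      simp [mul_add, add_mul, mul_assoc, hX]
    have e2 : v ⬝ᵥ (A ^ m * (vecMulVec v v * X)) *ᵥ v =
        (v ⬝ᵥ (A ^ m) *ᵥ v) * (v ⬝ᵥ X *ᵥ v) := by
      rw [← mulVec_mulVec, ← mulVec_mulVec, vecMulVec_mulVec]
      simp [mulVec_smul, mul_comm]
    have h0 := ih 0
    rw [pow_zero, one_mul] at h0
    simp only [pow_zero, one_mul] at h0
    have hm : v ⬝ᵥ (A ^ m) *ᵥ v = ∑ i, (Uᵀ *ᵥ v) i ^ 2 * f i ^ m := by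
      rw [hA, conj_diagonal_pow hU hU', dotProduct_conj_diagonal_mulVec]
    have hmono : Monovary (fun i => f i ^ m) (fun i => (f i + s) ^ k) := by
      intro i j hij
      refine pow_le_pow_left₀ (hf i) ?_ m
      by_contra hlt
      exact absurd (pow_le_pow_left₀ (add_nonneg (hf j) hs)
        (add_le_add_left (not_le.1 hlt).le s) k) (not_le.2 hij)
    have hc := sum_mul_sum_le_of_monovary (w := fun i => (Uᵀ *ᵥ v) i ^ 2)
      (fun i => sq_nonneg _) (by rw [sum_transpose_mulVec_sq hU', hv]) hmono
    have hm0 : 0 ≤ v ⬝ᵥ (A ^ m) *ᵥ v := by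
      rw [hm]
      exact Finset.sum_nonneg fun i _ => mul_nonneg (sq_nonneg _) (pow_nonneg (hf i) _)
    rw [e, add_mulVec, dotProduct_add, smul_mulVec, dotProduct_smul, e2, smul_eq_mul]
    calc _ ≤ (∑ i, (Uᵀ *ᵥ v) i ^ 2 * (f i ^ (m + 1) * (f i + s) ^ k)) +
          s * ∑ i, (Uᵀ *ᵥ v) i ^ 2 * (f i ^ m * (f i + s) ^ k) := by
          refine add_le_add (ih (m + 1)) (mul_le_mul_of_nonneg_left ?_ hs)
          refine (mul_le_mul_of_nonneg_left h0 hm0).trans ?_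
          rw [hm]
          exact hc
      _ = _ := by
          rw [Finset.mul_sum, ← Finset.sum_add_distrib]
          refine Finset.sum_congr rfl fun i _ => ?_
          ring

section NormedMatrix

open scoped Matrix.Norms.Operator

theorem hasSum_dotProduct_exp_mulVec (A : Matrix ι ι ℝ) (v : ι → ℝ) :
    HasSum (fun k : ℕ => (k.factorial⁻¹ : ℝ) * (v ⬝ᵥ (A ^ k) *ᵥ v))
      (v ⬝ᵥ (NormedSpace.exp A) *ᵥ v) := by
  have h := NormedSpace.exp_series_hasSum_exp' (𝕂 := ℝ) A
  let L : Matrix ι ι ℝ →ₗ[ℝ] ℝ :=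
    { toFun := fun X => v ⬝ᵥ X *ᵥ v
      map_add' := fun X Y => by rw [add_mulVec, dotProduct_add]
      map_smul' := fun c X => by simp [smul_mulVec] }
  have := h.mapL (LinearMap.toContinuousLinearMap L)
  simp only [L, LinearMap.coe_toContinuousLinearMap', LinearMap.coe_mk, AddHom.coe_mk, smul_mulVec,
    dotProduct_smul, smul_eq_mul] at this
  exact this

theorem hasSum_trace_exp (A : Matrix ι ι ℝ) :
    HasSum (fun k : ℕ => (k.factorial⁻¹ : ℝ) * (A ^ k).trace) (NormedSpace.exp A).trace := by
  have h := NormedSpace.exp_series_hasSum_exp' (𝕂 := ℝ) A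
  have := h.mapL (LinearMap.toContinuousLinearMap (traceLinearMap ι ℝ ℝ))
  simp only [LinearMap.coe_toContinuousLinearMap', traceLinearMap_apply, trace_smul,
    smul_eq_mul] at this
  exact this

end NormedMatrix

theorem isHermitian_vecMulVec_self {ι : Type*} (v : ι → ℝ) : (vecMulVec v v).IsHermitian := by
  ext i j; simp [vecMulVec_apply, mul_comm]

theorem IsHermitian.smul_real {ι : Type*} {A : Matrix ι ι ℝ} (hA : A.IsHermitian) (s : ℝ) :
    (s • A).IsHermitian := by
  rw [IsHermitian, conjTranspose_smul, hA.eq, star_trivial]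

theorem trace_mul_vecMulVec_self {ι : Type*} [Fintype ι] (X : Matrix ι ι ℝ) (v : ι → ℝ) :
    (X * vecMulVec v v).trace = v ⬝ᵥ X *ᵥ v := by
  rw [mul_vecMulVec, trace_vecMulVec, dotProduct_comm]

theorem IsHermitian.exp_add_smul_one {A : Matrix ι ι ℝ} (hA : A.IsHermitian) (c : ℝ) :
    NormedSpace.exp (A + c • 1) = Real.exp c • NormedSpace.exp A := by
  obtain ⟨U, hU, hU', h⟩ := hA.exists_orthogonal_diagonal
  rw [h, conj_diagonal_add_smul_one hU', exp_conj_diagonal hU, exp_conj_diagonal hU,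
    ← smul_mul_assoc, ← mul_smul_comm, ← diagonal_smul]
  congr 4
  ext i
  simp [Real.exp_add, mul_comm]

/-- Along a rank-one perturbation the quadratic form of the exponential grows at most as in the
commutative case. -/
theorem IsHermitian.dotProduct_exp_add_smul_vecMulVec_le {A : Matrix ι ι ℝ} (hA : A.IsHermitian)
    {v : ι → ℝ} (hv : v ⬝ᵥ v = 1) {s : ℝ} (hs : 0 ≤ s) :
    v ⬝ᵥ (NormedSpace.exp (A + s • vecMulVec v v)) *ᵥ v ≤
      Real.exp s * (v ⬝ᵥ (NormedSpace.exp A) *ᵥ v) := by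
  obtain ⟨U, hU, hU', h⟩ := hA.exists_orthogonal_diagonal
  set μ := hA.eigenvalues
  -- The comparison of powers needs a nonnegative spectrum. Shifting by `c` provides it and
  -- multiplies both exponentials by `Real.exp c`, which cancels at the end.
  set c := ∑ i, |μ i|
  have hf : ∀ i, 0 ≤ μ i + c := fun i => by
    have := Finset.single_le_sum (f := fun i => |μ i|) (fun i _ => abs_nonneg _)
      (Finset.mem_univ i)
    have h2 := neg_abs_le (μ i)
    linarith
  have hP : (A + s • vecMulVec v v).IsHermitian :=
    hA.add ((isHermitian_vecMulVec_self v).smul_real s)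
  have key : v ⬝ᵥ (NormedSpace.exp (U * diagonal (fun i => μ i + c) * Uᵀ + s • vecMulVec v v)) *ᵥ v
      ≤ v ⬝ᵥ (NormedSpace.exp (U * diagonal (fun i => μ i + c + s) * Uᵀ)) *ᵥ v := by
    refine hasSum_le (fun k => ?_) (hasSum_dotProduct_exp_mulVec _ v)
      (hasSum_dotProduct_exp_mulVec _ v)
    refine mul_le_mul_of_nonneg_left ?_ (by positivity)
    have := dotProduct_pow_mul_pow_add_vecMulVec_le hU hU' hf hv hs k 0
    rw [conj_diagonal_pow hU hU', dotProduct_conj_diagonal_mulVec]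
    simpa using this
  rw [← conj_diagonal_add_smul_one hU', ← conj_diagonal_add_smul_one hU', ← h, add_right_comm,
    hP.exp_add_smul_one, ← conj_diagonal_add_smul_one hU', ← h, add_assoc, ← add_smul, hA.exp_add_smul_one, smul_mulVec, smul_mulVec,
    dotProduct_smul, dotProduct_smul, Real.exp_add, smul_eq_mul, smul_eq_mul, mul_assoc] at key
  exact le_of_mul_le_mul_left key (Real.exp_pos c)

theorem IsHermitian.dotProduct_exp_mulVec_nonneg {A : Matrix ι ι ℝ} (hA : A.IsHermitian)
    (v : ι → ℝ) : 0 ≤ v ⬝ᵥ (NormedSpace.exp A) *ᵥ v := by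
  obtain ⟨U, hU, hU', h⟩ := hA.exists_orthogonal_diagonal
  rw [h, exp_conj_diagonal hU, dotProduct_conj_diagonal_mulVec]
  positivity

theorem IsHermitian.trace_exp_nonneg {A : Matrix ι ι ℝ} (hA : A.IsHermitian) :
    0 ≤ (NormedSpace.exp A).trace := by
  obtain ⟨U, hU, hU', h⟩ := hA.exists_orthogonal_diagonal
  rw [h, exp_conj_diagonal hU, trace_conj_diagonal hU]
  positivity

/-- Jensen's inequality for the spectral weights of `v`, each of which is at most 1. -/
theorem IsHermitian.exp_dotProduct_le_trace_exp {A : Matrix ι ι ℝ} (hA : A.IsHermitian)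
    {v : ι → ℝ} (hv : v ⬝ᵥ v = 1) : Real.exp (v ⬝ᵥ A *ᵥ v) ≤ (NormedSpace.exp A).trace := by
  obtain ⟨U, hU, hU', h⟩ := hA.exists_orthogonal_diagonal
  set μ := hA.eigenvalues
  have hw : ∑ i, (Uᵀ *ᵥ v) i ^ 2 = 1 := by rw [sum_transpose_mulVec_sq hU', hv]
  rw [h, exp_conj_diagonal hU, trace_conj_diagonal hU, dotProduct_conj_diagonal_mulVec]
  have hJ := convexOn_exp.map_sum_le (t := Finset.univ) (w := fun i => (Uᵀ *ᵥ v) i ^ 2) (p := μ)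
    (fun i _ => sq_nonneg _) hw (fun i _ => Set.mem_univ _)
  simp only [smul_eq_mul] at hJ
  refine hJ.trans (Finset.sum_le_sum fun i _ => ?_)
  refine mul_le_of_le_one_left (Real.exp_nonneg _) ?_
  rw [← hw]
  exact Finset.single_le_sum (f := fun i => (Uᵀ *ᵥ v) i ^ 2) (fun i _ => sq_nonneg _)
    (Finset.mem_univ i)

section NormedMatrix

open scoped Matrix.Norms.Operator

/-- The product rule gives `k` terms that differ by the position of the projection; under the trace
they all agree by cyclicity. -/
theorem hasDerivAt_trace_pow_add_smul_vecMulVec (A : Matrix ι ι ℝ) (v : ι → ℝ) (k : ℕ) (t : ℝ) :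
    HasDerivAt (fun t : ℝ => ((A + t • vecMulVec v v) ^ k).trace)
      (k * (v ⬝ᵥ ((A + t • vecMulVec v v) ^ (k - 1)) *ᵥ v)) t := by
  have h1 : HasDerivAt (fun t : ℝ => A + t • vecMulVec v v) (vecMulVec v v) t := by
    have := ((hasDerivAt_id t).smul_const (vecMulVec v v)).const_add A
    rwa [one_smul] at this
  have h2 := h1.fun_pow' k
  have h3 := (LinearMap.toContinuousLinearMap (traceLinearMap ι ℝ ℝ)).hasFDerivAt.comp_hasDerivAt
    t h2
  have e : (k * (v ⬝ᵥ ((A + t • vecMulVec v v) ^ (k - 1)) *ᵥ v)) =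
      (∑ i ∈ Finset.range k, (A + t • vecMulVec v v) ^ (k.pred - i) * vecMulVec v v *
        (A + t • vecMulVec v v) ^ i).trace := by
    rw [trace_sum, Finset.sum_congr rfl (g := fun _ =>
      v ⬝ᵥ ((A + t • vecMulVec v v) ^ (k - 1)) *ᵥ v)]
    · simp
    · intro i hi
      rw [trace_mul_comm, ← mul_assoc, ← pow_add, trace_mul_vecMulVec_self]
      have := Finset.mem_range.1 hi
      congr 3
      rw [Nat.pred_eq_sub_one]
      omega
  rw [e]
  exact h3

theorem hasDerivAt_trace_exp_add_smul_vecMulVec (A : Matrix ι ι ℝ) {v : ι → ℝ}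
    (hv : v ⬝ᵥ v = 1) (t : ℝ) :
    HasDerivAt (fun t : ℝ => (NormedSpace.exp (A + t • vecMulVec v v)).trace)
      (v ⬝ᵥ (NormedSpace.exp (A + t • vecMulVec v v)) *ᵥ v) t := by
  have hne : Nonempty ι := by
    by_contra h
    rw [not_nonempty_iff] at h
    simp [dotProduct] at hv
  set P := vecMulVec v v
  set K : ℝ := (∑ i, |v i|) * ‖v‖ with hK
  have hQ : ∀ X : Matrix ι ι ℝ, ‖v ⬝ᵥ X *ᵥ v‖ ≤ K * ‖X‖ := fun X => by
    calc ‖v ⬝ᵥ X *ᵥ v‖ ≤ ∑ i, ‖v i * (X *ᵥ v) i‖ := norm_sum_le _ _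
      _ ≤ ∑ i, |v i| * (‖X‖ * ‖v‖) := Finset.sum_le_sum fun i _ => by
          rw [norm_mul]
          -- The operator norm induced by the supremum norm bounds each coordinate of `X *ᵥ v`.
          exact mul_le_mul_of_nonneg_left ((norm_le_pi_norm _ i).trans (linfty_opNorm_mulVec X v))
            (norm_nonneg _)
      _ = K * ‖X‖ := by rw [← Finset.sum_mul, hK]; ring
  have hK0 : 0 ≤ K := mul_nonneg (Finset.sum_nonneg fun i _ => abs_nonneg _) (norm_nonneg _)
  set r : ℝ := ‖A‖ + (|t| + 1) * ‖P‖ with hr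
  set b : ℕ → ℝ := fun k => (k.factorial⁻¹ : ℝ) * (k * (K * r ^ (k - 1))) with hb
  have shift : ∀ k : ℕ, ((k + 1).factorial⁻¹ : ℝ) * ((k + 1 : ℕ) : ℝ) = (k.factorial⁻¹ : ℝ) := by
    intro k
    rw [Nat.factorial_succ]
    push_cast
    have : (k : ℝ) + 1 ≠ 0 := by positivity
    field_simp
  have hbs : Summable b := by
    rw [← summable_nat_add_iff 1]
    refine ((Real.summable_pow_div_factorial r).mul_left K).congr fun k => ?_
    simp only [hb]
    rw [← mul_assoc, shift, Nat.add_sub_cancel]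
    ring
  -- The exponential series is differentiated term by term on the unit ball around `t`, where `r`
  -- bounds the norm of `A + s • P`.
  have hd := hasDerivAt_tsum_of_isPreconnected (u := b) (t := Metric.ball t 1) (y := t) (y₀ := t)
    (g := fun k s => (k.factorial⁻¹ : ℝ) * ((A + s • P) ^ k).trace)
    (g' := fun k s => (k.factorial⁻¹ : ℝ) * (k * (v ⬝ᵥ ((A + s • P) ^ (k - 1)) *ᵥ v)))
    hbs Metric.isOpen_ball (convex_ball t 1).isPreconnected
    (fun k s _ => (hasDerivAt_trace_pow_add_smul_vecMulVec A v k s).const_mul _)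
    (fun k s hs => by
      rw [norm_mul, norm_mul, Real.norm_of_nonneg (by positivity : (0 : ℝ) ≤ (k.factorial⁻¹ : ℝ)),
        Real.norm_of_nonneg (by positivity : (0 : ℝ) ≤ (k : ℝ))]
      refine mul_le_mul_of_nonneg_left (mul_le_mul_of_nonneg_left ?_ (by positivity))
        (by positivity)
      refine (hQ _).trans (mul_le_mul_of_nonneg_left ?_ hK0)
      refine (norm_pow_le _ _).trans (pow_le_pow_left₀ (norm_nonneg _) ?_ _)
      refine (norm_add_le _ _).trans (add_le_add le_rfl ?_)
      rw [norm_smul]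
      refine mul_le_mul_of_nonneg_right ?_ (norm_nonneg _)
      have h1 : |s - t| < 1 := by simpa [Real.dist_eq] using hs
      have h2 := abs_sub_abs_le_abs_sub s t
      rw [Real.norm_eq_abs]
      linarith)
    (Metric.mem_ball_self one_pos) (hasSum_trace_exp _).summable (Metric.mem_ball_self one_pos)
  have e1 : (fun s : ℝ => ∑' k : ℕ, (k.factorial⁻¹ : ℝ) * ((A + s • P) ^ k).trace) =
      fun s => (NormedSpace.exp (A + s • P)).trace := funext fun s => (hasSum_trace_exp _).tsum_eq
  have e2 : ∑' k : ℕ, (k.factorial⁻¹ : ℝ) * (k * (v ⬝ᵥ ((A + t • P) ^ (k - 1)) *ᵥ v)) =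
      v ⬝ᵥ (NormedSpace.exp (A + t • P)) *ᵥ v := by
    have h := hasSum_dotProduct_exp_mulVec (A + t • P) v
    -- The term with `k = 0` vanishes, and the shift by one turns `k / k!` into the coefficients of
    -- the exponential.
    refine HasSum.tsum_eq ((hasSum_nat_add_iff' 1).1 ?_)
    simp only [Finset.range_one, Finset.sum_singleton, Nat.cast_zero, zero_mul, mul_zero, sub_zero]
    refine Eq.mp (congrArg (HasSum · _) (funext fun k => ?_)) h
    rw [Nat.add_sub_cancel, ← mul_assoc, shift]
  rw [e1, e2] at hd
  exact hd

end NormedMatrix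


/-- The Golden-Thompson inequality for a multiple of a rank-one projection. -/
theorem IsHermitian.trace_exp_add_smul_vecMulVec_le {A : Matrix ι ι ℝ} (hA : A.IsHermitian)
    {v : ι → ℝ} (hv : v ⬝ᵥ v = 1) (s : ℝ) :
    (NormedSpace.exp (A + s • vecMulVec v v)).trace ≤
      (NormedSpace.exp A).trace + (Real.exp s - 1) * (v ⬝ᵥ (NormedSpace.exp A) *ᵥ v) := by
  set g : ℝ → ℝ := fun t => v ⬝ᵥ (NormedSpace.exp (A + t • vecMulVec v v)) *ᵥ v with hg
  set F : ℝ → ℝ := fun t => (NormedSpace.exp (A + t • vecMulVec v v)).trace with hF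
  have g0 : g 0 = v ⬝ᵥ (NormedSpace.exp A) *ᵥ v := by simp [hg]
  have F0 : F 0 = (NormedSpace.exp A).trace := by simp [hF]
  have grow : ∀ t u, 0 ≤ u → g (t + u) ≤ Real.exp u * g t := fun t u hu => by
    have hP : (A + t • vecMulVec v v).IsHermitian :=
      hA.add ((isHermitian_vecMulVec_self v).smul_real t)
    have := hP.dotProduct_exp_add_smul_vecMulVec_le hv hu
    rwa [add_assoc, ← add_smul] at this
  -- The claim is `h 0 ≤ h s`. The derivative `Real.exp t * g 0 - g t` has the sign of `t`, so `h`
  -- is minimal at 0.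
  set h : ℝ → ℝ := fun t => Real.exp t * g 0 - F t with hh
  have hd : ∀ t, HasDerivAt h (Real.exp t * g 0 - g t) t := fun t =>
    ((Real.hasDerivAt_exp t).mul_const _).sub (hasDerivAt_trace_exp_add_smul_vecMulVec A hv t)
  have hc : Continuous h := continuous_iff_continuousAt.2 fun t => (hd t).continuousAt
  have main : h 0 ≤ h s := by
    rcases le_total 0 s with hs | hs
    · refine monotoneOn_of_deriv_nonneg (convex_Ici (0 : ℝ)) hc.continuousOn
        (fun t _ => (hd t).differentiableAt.differentiableWithinAt) (fun t ht => ?_)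
        (Set.mem_Ici.2 le_rfl) (Set.mem_Ici.2 hs) hs
      rw [interior_Ici] at ht
      rw [(hd t).deriv]
      have := grow 0 t (le_of_lt ht)
      rw [zero_add] at this
      linarith
    · refine antitoneOn_of_deriv_nonpos (convex_Iic (0 : ℝ)) hc.continuousOn
        (fun t _ => (hd t).differentiableAt.differentiableWithinAt) (fun t ht => ?_)
        (Set.mem_Iic.2 hs) (Set.mem_Iic.2 le_rfl) hs
      rw [interior_Iic] at ht
      rw [(hd t).deriv]
      -- For negative `t` the growth bound is applied on the way from `t` up to 0.
      have := grow t (-t) (neg_nonneg.2 (le_of_lt ht))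
      rw [add_neg_cancel, Real.exp_neg] at this
      have h2 := mul_le_mul_of_nonneg_left this (Real.exp_pos t).le
      rw [← mul_assoc, mul_inv_cancel₀ (Real.exp_pos t).ne', one_mul] at h2
      linarith
  simp only [hh, Real.exp_zero, g0, F0] at main
  linarith

/-- A random multiple of a rank-one projection with exponential mean at most one does not increase
the mean of the trace of the exponential. -/
theorem IsHermitian.trace_exp_add_smul_vecMulVec_mean_le {A : Matrix ι ι ℝ} (hA : A.IsHermitian)
    {v : ι → ℝ} (hv : v ⬝ᵥ v = 1) {p a b : ℝ} (hp0 : 0 ≤ p) (hp1 : p ≤ 1)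
    (h : p * Real.exp a + (1 - p) * Real.exp b ≤ 1) :
    p * (NormedSpace.exp (A + a • vecMulVec v v)).trace +
      (1 - p) * (NormedSpace.exp (A + b • vecMulVec v v)).trace ≤ (NormedSpace.exp A).trace := by
  have h1 := mul_le_mul_of_nonneg_left (hA.trace_exp_add_smul_vecMulVec_le hv a) hp0
  have h2 := mul_le_mul_of_nonneg_left (hA.trace_exp_add_smul_vecMulVec_le hv b)
    (sub_nonneg.2 hp1)
  have h3 := mul_nonneg (sub_nonneg.2 h) (hA.dotProduct_exp_mulVec_nonneg v)
  nlinarith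

/-! ### Courant-Fischer -/

/-- The span of some of the eigenvectors of a symmetric matrix, on which the quadratic form is a
sum of squares with the corresponding eigenvalues as coefficients. -/
theorem IsHermitian.exists_submodule_of_injective {A : Matrix ι ι ℝ} (hA : A.IsHermitian)
    {κ : Type*} [Fintype κ] {s : κ → ι} (hs : Function.Injective s) :
    ∃ W : Submodule ℝ (ι → ℝ), Module.finrank ℝ W = Fintype.card κ ∧
      ∀ x ∈ W, ∃ z : κ → ℝ, x ⬝ᵥ x = ∑ i, z i ^ 2 ∧
        x ⬝ᵥ A *ᵥ x = ∑ i, z i ^ 2 * hA.eigenvalues (s i) := by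
  classical
  obtain ⟨U, hU, hU', h⟩ := hA.exists_orthogonal_diagonal
  let E := Function.ExtendByZero.linearMap ℝ s
  have hE : ∀ z i, E z (s i) = z i := fun z i => hs.extend_apply z 0 i
  have hE0 : ∀ z j, j ∉ Set.range s → E z j = 0 := fun z j hj => by
    have := Function.extend_apply' z (0 : ι → ℝ) j (fun ⟨a, ha⟩ => hj ⟨a, ha⟩)
    exact this
  let L := (mulVecLin U).comp E
  have hUL : ∀ z, Uᵀ *ᵥ L z = E z := fun z => by
    change Uᵀ *ᵥ (U *ᵥ E z) = E z
    rw [mulVec_mulVec, hU, one_mulVec]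
  have hsum : ∀ z, ∀ f : ι → ℝ, ∑ j, E z j ^ 2 * f j = ∑ i, z i ^ 2 * f (s i) := fun z f => by
    rw [← Finset.sum_subset (Finset.subset_univ (Finset.univ.image s)),
      Finset.sum_image (fun a _ b _ hab => hs hab)]
    · simp only [hE]
    · intro j _ hj
      rw [hE0 z j (by simpa using hj)]
      simp
  have hinj : Function.Injective L := fun y z hyz => by
    ext i
    rw [← hE y, ← hE z, ← hUL y, ← hUL z, hyz]
  refine ⟨LinearMap.range L, ?_, ?_⟩
  · rw [LinearMap.finrank_range_of_inj hinj, Module.finrank_fintype_fun_eq_card]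
  · rintro _ ⟨z, rfl⟩
    refine ⟨z, ?_, ?_⟩
    · rw [← sum_transpose_mulVec_sq hU', hUL]
      simpa using hsum z (fun _ => 1)
    · conv_lhs => rw [h]
      rw [dotProduct_conj_diagonal_mulVec, hUL]
      exact hsum z _

theorem IsHermitian.eigenvalues_equiv {A : Matrix ι ι ℝ} (hA : A.IsHermitian) :
    ∃ e : Fin (Fintype.card ι) ≃ ι, ∀ i, hA.eigenvalues (e i) = hA.eigenvalues₀ i :=
  ⟨Fintype.equivOfCardEq (Fintype.card_fin _), fun i => by simp [IsHermitian.eigenvalues]⟩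

theorem IsHermitian.exists_submodule_eigenvalues₀_le {A : Matrix ι ι ℝ} (hA : A.IsHermitian)
    (a : Fin (Fintype.card ι)) :
    ∃ W : Submodule ℝ (ι → ℝ), Module.finrank ℝ W = a + 1 ∧
      ∀ x ∈ W, hA.eigenvalues₀ a * (x ⬝ᵥ x) ≤ x ⬝ᵥ A *ᵥ x := by
  obtain ⟨e, he⟩ := hA.eigenvalues_equiv
  obtain ⟨W, hW, h⟩ := hA.exists_submodule_of_injective
    (s := fun i : Finset.Iic a => e i) (fun i j hij => Subtype.ext (e.injective hij))
  refine ⟨W, by rw [hW, Fintype.card_coe, Fin.card_Iic], fun x hx => ?_⟩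
  obtain ⟨z, h1, h2⟩ := h x hx
  rw [h1, h2, Finset.mul_sum]
  refine Finset.sum_le_sum fun i _ => ?_
  rw [mul_comm, he]
  exact mul_le_mul_of_nonneg_left (hA.eigenvalues₀_antitone (Finset.mem_Iic.1 i.2)) (sq_nonneg _)

/-- One direction of the Courant-Fischer theorem. -/
theorem IsHermitian.le_eigenvalues₀_of_submodule {A : Matrix ι ι ℝ} (hA : A.IsHermitian)
    (a : Fin (Fintype.card ι)) {W : Submodule ℝ (ι → ℝ)} (hW : Module.finrank ℝ W = a + 1) {c : ℝ}
    (h : ∀ x ∈ W, c * (x ⬝ᵥ x) ≤ x ⬝ᵥ A *ᵥ x) : c ≤ hA.eigenvalues₀ a := by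
  obtain ⟨e, he⟩ := hA.eigenvalues_equiv
  obtain ⟨W', hW', h'⟩ := hA.exists_submodule_of_injective
    (s := fun i : Finset.Ici a => e i) (fun i j hij => Subtype.ext (e.injective hij))
  rw [Fintype.card_coe, Fin.card_Ici] at hW'
  have hsum := Submodule.finrank_sup_add_finrank_inf_eq W W'
  have hle := Submodule.finrank_le (W ⊔ W')
  rw [Module.finrank_fintype_fun_eq_card] at hle
  -- The eigenvalues decrease, so `W'` has dimension `card ι - a` and carries those up to the one at
  -- `a`; the dimensions of `W` and `W'` exceed that of the space by one.
  have hpos : 0 < Module.finrank ℝ (W ⊓ W' : Submodule ℝ (ι → ℝ)) := by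
    have := a.2
    omega
  have hne : (W ⊓ W' : Submodule ℝ (ι → ℝ)) ≠ ⊥ := fun hb => by
    rw [hb, finrank_bot] at hpos
    exact lt_irrefl _ hpos
  obtain ⟨x, hx, hx0⟩ := (Submodule.ne_bot_iff _).1 hne
  obtain ⟨z, h1, h2⟩ := h' x hx.2
  have hxx : 0 < x ⬝ᵥ x := by
    refine lt_of_le_of_ne (Finset.sum_nonneg fun i _ => mul_self_nonneg _) fun h0 => hx0 ?_
    exact dotProduct_self_eq_zero.1 h0.symm
  refine le_of_mul_le_mul_right ((h x hx.1).trans ?_) hxx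
  rw [h1, h2, Finset.mul_sum]
  refine Finset.sum_le_sum fun i _ => ?_
  rw [mul_comm, he]
  exact mul_le_mul_of_nonneg_right (hA.eigenvalues₀_antitone (Finset.mem_Ici.1 i.2)) (sq_nonneg _)

end Matrix

/-! ### Energy, degrees and the eigenvalues of the normalised Laplacian -/

namespace WGraph

open Matrix

variable {V : Type u} [Fintype V]

/-- The quadratic form of the Laplacian of a weighted graph. -/
def energy (G : WGraph V) (z : V → ℝ) : ℝ := (∑ x, ∑ y, G.w x y * (z x - z y) ^ 2) / 2

theorem energy_nonneg (G : WGraph V) (z : V → ℝ) : 0 ≤ G.energy z :=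
  div_nonneg (Finset.sum_nonneg fun x _ => Finset.sum_nonneg fun y _ =>
    mul_nonneg (G.nonneg x y) (sq_nonneg _)) zero_le_two

theorem sum_sum_weight_mul_sq (G : WGraph V) (z : V → ℝ) :
    ∑ x, ∑ y, G.w x y * z x ^ 2 = ∑ x, G.deg x * z x ^ 2 := by
  simp only [deg, Finset.sum_mul]

theorem sum_sum_weight_mul_sq' (G : WGraph V) (z : V → ℝ) :
    ∑ x, ∑ y, G.w x y * z y ^ 2 = ∑ x, G.deg x * z x ^ 2 := by
  rw [Finset.sum_comm, ← sum_sum_weight_mul_sq]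
  simp only [G.symm]

theorem energy_eq (G : WGraph V) (z : V → ℝ) :
    G.energy z = ∑ x, G.deg x * z x ^ 2 - ∑ x, ∑ y, G.w x y * (z x * z y) := by
  have e : ∀ x y, G.w x y * (z x - z y) ^ 2 = G.w x y * z x ^ 2 + G.w x y * z y ^ 2 -
      2 * (G.w x y * (z x * z y)) := fun x y => by ring
  simp only [energy, e, Finset.sum_sub_distrib, Finset.sum_add_distrib, ← Finset.mul_sum,
    sum_sum_weight_mul_sq, sum_sum_weight_mul_sq']
  ring

theorem energy_le (G : WGraph V) (z : V → ℝ) : G.energy z ≤ 2 * ∑ x, G.deg x * z x ^ 2 := by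
  have : ∑ x, ∑ y, G.w x y * (z x - z y) ^ 2 ≤
      ∑ x, ∑ y, (2 * (G.w x y * z x ^ 2) + 2 * (G.w x y * z y ^ 2)) :=
    Finset.sum_le_sum fun x _ => Finset.sum_le_sum fun y _ => by
      nlinarith [mul_nonneg (G.nonneg x y) (sq_nonneg (z x + z y))]
  simp only [Finset.sum_add_distrib, ← Finset.mul_sum, sum_sum_weight_mul_sq,
    sum_sum_weight_mul_sq'] at this
  rw [energy]
  linarith

theorem dotProduct_sqrt_deg (G : WGraph V) (z : V → ℝ) :
    (fun x => √(G.deg x) * z x) ⬝ᵥ (fun x => √(G.deg x) * z x) = ∑ x, G.deg x * z x ^ 2 := by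
  refine Finset.sum_congr rfl fun x _ => ?_
  rw [mul_mul_mul_comm, Real.mul_self_sqrt (G.deg_nonneg x), sq]

theorem sqrt_deg_mul_div (G : WGraph V) (hG : ∀ x, 0 < G.deg x) (x : V → ℝ) :
    (fun v => √(G.deg v) * (x v / √(G.deg v))) = x :=
  funext fun v => mul_div_cancel₀ _ (Real.sqrt_pos.2 (hG v)).ne'

variable [DecidableEq V]

theorem dotProduct_normLap_mulVec (G : WGraph V) (hG : ∀ x, 0 < G.deg x) (z : V → ℝ) :
    (fun x => √(G.deg x) * z x) ⬝ᵥ G.normLap *ᵥ (fun x => √(G.deg x) * z x) = G.energy z := by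
  rw [normLap, sub_mulVec, dotProduct_sub, one_mulVec, dotProduct_sqrt_deg, energy_eq]
  congr 1
  refine Finset.sum_congr rfl fun x _ => ?_
  rw [mulVec, dotProduct, Finset.mul_sum]
  refine Finset.sum_congr rfl fun y _ => ?_
  have hx := (Real.sqrt_pos.2 (hG x)).ne'
  have hy := (Real.sqrt_pos.2 (hG y)).ne'
  rw [of_apply]
  field_simp

theorem exists_submodule_eig_le (G : WGraph V) {k : ℕ} (hk : k < Fintype.card V) :
    ∃ W : Submodule ℝ (V → ℝ), Module.finrank ℝ W = Fintype.card V - k ∧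
      ∀ x ∈ W, G.eig ⟨k, hk⟩ * (x ⬝ᵥ x) ≤ x ⬝ᵥ G.normLap *ᵥ x := by
  obtain ⟨W, hW, h⟩ := G.normLap_isHermitian.exists_submodule_eigenvalues₀_le (Fin.rev ⟨k, hk⟩)
  refine ⟨W, ?_, h⟩
  rw [hW, Fin.val_rev]
  simp only
  omega

theorem le_eig_of_submodule (G : WGraph V) {k : ℕ} (hk : k < Fintype.card V)
    {W : Submodule ℝ (V → ℝ)} (hW : Module.finrank ℝ W = Fintype.card V - k) {c : ℝ}
    (h : ∀ x ∈ W, c * (x ⬝ᵥ x) ≤ x ⬝ᵥ G.normLap *ᵥ x) : c ≤ G.eig ⟨k, hk⟩ := by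
  refine G.normLap_isHermitian.le_eigenvalues₀_of_submodule _ ?_ h
  rw [hW, Fin.val_rev]
  simp only
  omega

theorem eig_le_two (G : WGraph V) (hG : ∀ x, 0 < G.deg x) {k : ℕ} (hk : k < Fintype.card V) :
    G.eig ⟨k, hk⟩ ≤ 2 := by
  obtain ⟨W, hW, h⟩ := G.exists_submodule_eig_le hk
  have hne : W ≠ ⊥ := fun hb => by
    rw [hb, finrank_bot] at hW
    omega
  obtain ⟨x, hx, hx0⟩ := (Submodule.ne_bot_iff _).1 hne
  have hxx : 0 < x ⬝ᵥ x := by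
    refine lt_of_le_of_ne (Finset.sum_nonneg fun i _ => mul_self_nonneg _) fun h0 => hx0 ?_
    exact dotProduct_self_eq_zero.1 h0.symm
  refine le_of_mul_le_mul_right ((h x hx).trans ?_) hxx
  rw [← G.sqrt_deg_mul_div hG x, dotProduct_normLap_mulVec G hG, dotProduct_sqrt_deg]
  exact G.energy_le _

/-- Comparison of the eigenvalues of two graphs through their energies and degrees. -/
theorem eig_div_le_eig (G H : WGraph V) (hG : ∀ x, 0 < G.deg x) (hH : ∀ x, 0 < H.deg x) {k : ℕ}
    (hk : k < Fintype.card V) (hpos : 0 < G.eig ⟨k, hk⟩) {a : ℝ} (ha : 0 < a)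
    (hd : ∀ x, H.deg x ≤ a * G.deg x)
    (hE : ∀ z, G.energy z / 2 - G.eig ⟨k, hk⟩ / 4 * ∑ x, G.deg x * z x ^ 2 ≤ H.energy z) :
    G.eig ⟨k, hk⟩ / (4 * a) ≤ H.eig ⟨k, hk⟩ := by
  obtain ⟨W, hW, h⟩ := G.exists_submodule_eig_le hk
  -- The test space of `G` is moved to `H` by keeping `z` fixed, where `z` is the vector before
  -- scaling by the square roots of the degrees.
  let L : (V → ℝ) →ₗ[ℝ] (V → ℝ) :=
    mulVecLin (diagonal fun v => √(H.deg v) / √(G.deg v))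
  have hL : ∀ x, L x = fun v => √(H.deg v) * (x v / √(G.deg v)) := fun x => by
    ext v
    simp only [L, mulVecLin_apply, mulVec_diagonal]
    ring
  have hLi : Function.Injective L := fun x y hxy => by
    ext v
    have := congrFun hxy v
    rw [hL, hL] at this
    have h1 := mul_left_cancel₀ (Real.sqrt_pos.2 (hH v)).ne' this
    exact (div_left_inj' (Real.sqrt_pos.2 (hG v)).ne').1 h1
  refine le_eig_of_submodule H hk (W := W.map L)
    (by rw [← hW]; exact (Submodule.equivMapOfInjective L hLi W).finrank_eq.symm) ?_
  rintro _ ⟨x, hx, rfl⟩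
  rw [hL, dotProduct_sqrt_deg, dotProduct_normLap_mulVec H hH]
  have h1 := h x hx
  rw [← G.sqrt_deg_mul_div hG x, dotProduct_normLap_mulVec G hG, dotProduct_sqrt_deg] at h1
  set z : V → ℝ := fun v => x v / √(G.deg v)
  have h2 : ∑ v, H.deg v * z v ^ 2 ≤ a * ∑ v, G.deg v * z v ^ 2 := by
    rw [Finset.mul_sum]
    refine Finset.sum_le_sum fun v _ => ?_
    rw [← mul_assoc]
    exact mul_le_mul_of_nonneg_right (hd v) (sq_nonneg _)
  calc _ ≤ G.eig ⟨k, hk⟩ / (4 * a) * (a * ∑ v, G.deg v * z v ^ 2) :=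
        mul_le_mul_of_nonneg_left h2 (by positivity)
    _ = G.eig ⟨k, hk⟩ / 4 * ∑ v, G.deg v * z v ^ 2 := by field_simp
    _ ≤ H.energy z := by
        refine le_trans ?_ (hE z)
        have : G.eig ⟨k, hk⟩ * ∑ v, G.deg v * z v ^ 2 ≤ G.energy z := h1
        linarith

end WGraph

/-! ### Independent events, and Markov's inequality -/

theorem measurable_mem_and_mem {Ω E : Type*} [MeasurableSpace Ω] {A : E → Set Ω} (s : Finset E)
    (hA : ∀ e ∈ s, MeasurableSet (A e)) : Measurable fun ω e => e ∈ s ∧ ω ∈ A e := by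
  refine measurable_pi_iff.2 fun e => ?_
  by_cases h : e ∈ s
  · simpa [h] using (hA e h).mem
  · simp [h]

section Independence

variable {Ω : Type*} [mΩ : MeasurableSpace Ω] {μ : Measure Ω}

/-- Events that depend on disjoint blocks of independent random variables are independent. -/
theorem iIndepFun.iIndepSet_of_blocks {J E β : Type*} [MeasurableSpace β] {X : J → Ω → β}
    (hX : iIndepFun X μ) (hXm : ∀ j, Measurable (X j)) (q : J → E) {A : E → Set Ω}
    (hA : ∀ e, MeasurableSet[⨆ j ∈ q ⁻¹' {e}, MeasurableSpace.comap (X j) inferInstance] (A e)) :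
    iIndepSet A μ := by
  classical
  have := hX.isProbabilityMeasure
  have hle : ∀ j, MeasurableSpace.comap (X j) inferInstance ≤ mΩ := fun j => (hXm j).comap_le
  have hm : ∀ e, MeasurableSet (A e) := fun e => iSup₂_le (fun j _ => hle j) _ (hA e)
  rw [iIndepSet_iff_meas_biInter hm]
  intro s
  induction s using Finset.induction_on with
  | empty => simp
  | insert e s he ih =>
    rw [Finset.set_biInter_insert, Finset.prod_insert he, ← ih]
    have hd : Disjoint (q ⁻¹' {e}) (q ⁻¹' s) :=
      Disjoint.preimage _ (Set.disjoint_singleton_left.2 (by simpa using he))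
    have hi := indep_iSup_of_disjoint hle hX.iIndep hd
    refine (Indep_iff _ _ _).1 hi _ _ (hA e) ?_
    refine Finset.measurableSet_biInter s fun e' he' => ?_
    have hmono : (⨆ j ∈ q ⁻¹' {e'}, MeasurableSpace.comap (X j) inferInstance) ≤
        ⨆ j ∈ q ⁻¹' s, MeasurableSpace.comap (X j) (inferInstance : MeasurableSpace β) :=
      biSup_mono fun j hj => by
        have : q j = e' := hj
        simpa [this] using he'
    exact hmono _ (hA e')

variable {E : Type*} [Fintype E] {A : E → Set Ω}

/-- A random variable that only depends on which of finitely many events happen is integrable. -/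
theorem integrable_comp_mem [IsFiniteMeasure μ] (hA : ∀ e, MeasurableSet (A e))
    (g : (E → Prop) → ℝ) : Integrable (fun ω => g fun e => ω ∈ A e) μ := by
  have hX : Measurable fun ω => (fun e => ω ∈ A e : E → Prop) :=
    measurable_pi_iff.2 fun e => (hA e).mem
  exact (Integrable.of_finite (f := g)).comp_measurable hX

open Classical in
/-- If adding one random increment never increases the mean of `Ψ`, then adding all the increments
that are determined by a family of independent events does not increase it either. -/
theorem integral_sum_ite_le {X : Type*} [AddCommGroup X] (hi : iIndepSet A μ)
    (hA : ∀ e, MeasurableSet (A e)) (Q : AddSubgroup X) (Ψ : X → ℝ) (α β : E → X)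
    (hα : ∀ e, α e ∈ Q) (hβ : ∀ e, β e ∈ Q)
    (hΨ : ∀ e, ∀ x ∈ Q, μ.real (A e) * Ψ (x + α e) + (1 - μ.real (A e)) * Ψ (x + β e) ≤ Ψ x)
    (x : X) (hx : x ∈ Q) :
    ∫ ω, Ψ (x + ∑ e, if ω ∈ A e then α e else β e) ∂μ ≤ Ψ x := by
  have := hi.isProbabilityMeasure
  suffices h : ∀ s : Finset E, ∀ x ∈ Q,
      ∫ ω, Ψ (x + ∑ e ∈ s, if ω ∈ A e then α e else β e) ∂μ ≤ Ψ x from h Finset.univ x hx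
  have hint : ∀ (s : Finset E) (x : X),
      Integrable (fun ω => Ψ (x + ∑ e ∈ s, if ω ∈ A e then α e else β e)) μ := fun s x =>
    integrable_comp_mem hA fun P => Ψ (x + ∑ e ∈ s, if P e then α e else β e)
  intro s
  induction s using Finset.induction_on with
  | empty => simp
  | insert e s he ih =>
    intro x hx
    -- `Y` records only the events in `s`, hence is independent of `A e`. The integral splits over
    -- `A e` and its complement, and the induction hypothesis applies from the two shifted starting
    -- points, which stay in `Q`.
    let Y : Ω → E → Prop := fun ω e' => e' ∈ s ∧ ω ∈ A e'
    have hYm : Measurable[MeasurableSpace.generateFrom {t | ∃ n ∈ (s : Set E), A n = t}] Y := by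
      refine @measurable_mem_and_mem _ _ (MeasurableSpace.generateFrom _) A s fun e' he' => ?_
      exact MeasurableSpace.measurableSet_generateFrom ⟨e', he', rfl⟩
    have hgen : MeasurableSpace.generateFrom {t | ∃ n ∈ (s : Set E), A n = t} ≤ mΩ :=
      MeasurableSpace.generateFrom_le fun t ⟨n, _, hn⟩ => hn ▸ hA n
    have hind : Indep (MeasurableSpace.generateFrom {t | ∃ n ∈ ({e} : Set E), A n = t})
        (MeasurableSpace.comap Y inferInstance) μ :=
      indep_of_indep_of_le_right (hi.indep_generateFrom_of_disjoint hA {e} s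
        (Set.disjoint_singleton_left.2 (by simpa using he))) hYm.comap_le
    have hgen' : MeasurableSpace.generateFrom {t | ∃ n ∈ ({e} : Set E), A n = t} ≤ mΩ :=
      MeasurableSpace.generateFrom_le fun t ⟨n, _, hn⟩ => hn ▸ hA n
    have hAe : MeasurableSet[MeasurableSpace.generateFrom {t | ∃ n ∈ ({e} : Set E), A n = t}]
        (A e) := MeasurableSpace.measurableSet_generateFrom ⟨e, rfl, rfl⟩
    let f : X → (E → Prop) → ℝ := fun x P => Ψ (x + ∑ e ∈ s, if P e then α e else β e)
    have hf : ∀ x ω, f x (Y ω) = Ψ (x + ∑ e ∈ s, if ω ∈ A e then α e else β e) := fun x ω => by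
      simp only [f, Y]
      congr 2
      exact Finset.sum_congr rfl fun e' he' => by simp [he']
    have hset : ∀ (x : X) (B : Set Ω),
        MeasurableSet[MeasurableSpace.generateFrom {t | ∃ n ∈ ({e} : Set E), A n = t}] B →
        ∫ ω in B, f x (Y ω) ∂μ = μ.real B * ∫ ω, f x (Y ω) ∂μ := fun x B hB =>
      hind.setIntegral_eq_mul hgen' (hYm.mono hgen le_rfl).aemeasurable hB
        (Measurable.of_discrete).aestronglyMeasurable
    rw [← integral_add_compl (hA e) (hint _ _)]
    have h1 : ∫ ω in A e, Ψ (x + ∑ e ∈ insert e s, if ω ∈ A e then α e else β e) ∂μ =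
        ∫ ω in A e, f (x + α e) (Y ω) ∂μ := by
      refine setIntegral_congr_fun (hA e) fun ω hω => ?_
      simp only [hf]
      rw [Finset.sum_insert he, if_pos hω, add_assoc]
    have h2 : ∫ ω in (A e)ᶜ, Ψ (x + ∑ e ∈ insert e s, if ω ∈ A e then α e else β e) ∂μ =
        ∫ ω in (A e)ᶜ, f (x + β e) (Y ω) ∂μ := by
      refine setIntegral_congr_fun (hA e).compl fun ω hω => ?_
      simp only [hf]
      rw [Finset.sum_insert he, if_neg hω, add_assoc]
    rw [h1, h2, hset _ _ hAe, hset _ _ hAe.compl, probReal_compl_eq_one_sub (hA e)]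
    simp only [hf]
    refine le_trans (add_le_add (mul_le_mul_of_nonneg_left (ih _ (Q.add_mem hx (hα e))) ?_)
      (mul_le_mul_of_nonneg_left (ih _ (Q.add_mem hx (hβ e))) ?_)) (hΨ e x hx)
    · exact measureReal_nonneg
    · exact sub_nonneg.2 measureReal_le_one

end Independence

/-- Markov's inequality. -/
theorem measureReal_lt_le_of_integral_le {Ω : Type*} [MeasurableSpace Ω] {μ : Measure Ω}
    [IsProbabilityMeasure μ] {f : Ω → ℝ} (hf : Integrable f μ) (h0 : ∀ ω, 0 ≤ f ω) {m t : ℝ}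
    (hm : ∫ ω, f ω ∂μ ≤ m) (hm0 : 0 < m) (ht : 0 < t) :
    μ.real {ω | t * m < f ω} ≤ 1 / t := by
  have h := mul_meas_ge_le_integral_of_nonneg (ae_of_all μ h0) hf (t * m)
  have h1 : μ.real {ω | t * m < f ω} ≤ μ.real {ω | t * m ≤ f ω} :=
    measureReal_mono fun ω (hω : t * m < f ω) => show t * m ≤ f ω from hω.le
  rw [le_div_iff₀ ht]
  have h2 : t * m * μ.real {ω | t * m < f ω} ≤ m :=
    (mul_le_mul_of_nonneg_left h1 (by positivity)).trans (h.trans hm)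
  have h3 : m * (μ.real {ω | t * m < f ω} * t) ≤ m * 1 := by linarith
  exact le_of_mul_le_mul_left h3 hm0

/-! ### Scalar exponential bounds and the sampling probabilities -/

section Scalar

/-- Together with the next bound, this is the Chernoff estimate for one edge. An edge kept with
certainty is not random, so its scaled weight `a` may be large; otherwise `a ≤ 1` and the
exponential is bounded linearly. -/
theorem mul_exp_add_le_exp {p a : ℝ} (hp0 : 0 ≤ p) (hp1 : p ≤ 1) (ha0 : 0 ≤ a)
    (h : p = 1 ∨ a ≤ 1) : p * Real.exp a + (1 - p) ≤ Real.exp (2 * (p * a)) := by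
  rcases h with rfl | h
  · simpa using Real.exp_le_exp.2 (by linarith : a ≤ 2 * a)
  · have h1 : Real.exp a ≤ 1 + 2 * a := by
      have := Real.abs_exp_sub_one_sub_id_le (x := a) (by rw [abs_of_nonneg ha0]; exact h)
      have := (abs_le.1 this).2
      nlinarith
    have h2 := Real.add_one_le_exp (2 * (p * a))
    nlinarith

theorem mul_exp_neg_add_le_exp {p a : ℝ} (hp0 : 0 ≤ p) (hp1 : p ≤ 1) (ha0 : 0 ≤ a)
    (h : p = 1 ∨ a ≤ 1) : p * Real.exp (-a) + (1 - p) ≤ Real.exp (-(p * a / 2)) := by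
  rcases h with rfl | h
  · simpa using Real.exp_le_exp.2 (by linarith : -a ≤ -(a / 2))
  · have h1 : Real.exp (-a) ≤ 1 - a / 2 := by
      -- `(1 - a / 2) * (1 + a + a ^ 2 / 2) = 1 + a / 2 - a ^ 3 / 4`, which is at least 1 for `0 ≤ a
      -- ≤ 1`.
      have h3 := Real.quadratic_le_exp_of_nonneg ha0
      rw [Real.exp_neg, inv_le_iff_one_le_mul₀ (Real.exp_pos a)]
      nlinarith [mul_nonneg ha0 ha0, mul_nonneg ha0 (sub_nonneg.2 h),
        mul_le_mul_of_nonneg_left h3 (by linarith : 0 ≤ 1 - a / 2)]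
    have h2 := Real.add_one_le_exp (-(p * a / 2))
    nlinarith

end Scalar

section Prob

variable {n : ℕ} {τ : ℝ≥0} {a d d' : ℝ}

theorem sampleProb_nonneg (ha : 0 ≤ a) (hd : 0 ≤ d) : 0 ≤ sampleProb n τ a d :=
  le_min (mul_nonneg ha (div_nonneg (mul_nonneg τ.2 (Real.log_natCast_nonneg n)) hd)) zero_le_one

theorem sampleProb_le_one : sampleProb n τ a d ≤ 1 := min_le_right _ _

theorem sampleProb_zero : sampleProb n τ 0 d = 0 := by simp [sampleProb]

theorem edgeProb_zero : edgeProb n τ 0 d d' = 0 := by simp [edgeProb, sampleProb_zero]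

theorem edgeProb_le_one : edgeProb n τ a d d' ≤ 1 := by
  have h1 : sampleProb n τ a d ≤ 1 := sampleProb_le_one
  have h2 : sampleProb n τ a d' ≤ 1 := sampleProb_le_one
  unfold edgeProb
  nlinarith

theorem sampleProb_le_edgeProb (ha : 0 ≤ a) (hd' : 0 ≤ d') :
    sampleProb n τ a d ≤ edgeProb n τ a d d' := by
  have h1 : sampleProb n τ a d ≤ 1 := sampleProb_le_one
  have h2 : 0 ≤ sampleProb n τ a d' := sampleProb_nonneg ha hd'
  unfold edgeProb
  nlinarith

theorem sampleProb_pos (hL : 0 < τ * Real.log n) (ha : 0 < a) (hd : 0 < d) :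
    0 < sampleProb n τ a d := lt_min (by positivity) zero_lt_one

theorem edgeProb_pos (hL : 0 < τ * Real.log n) (ha : 0 < a) (hd : 0 < d) (hd' : 0 < d') :
    0 < edgeProb n τ a d d' :=
  (sampleProb_pos hL ha hd).trans_le (sampleProb_le_edgeProb ha.le hd'.le)

/-- Either an edge is kept with certainty, or its new weight is small compared with the degrees. -/
theorem edgeProb_eq_one_or_div_le (ha : 0 ≤ a) (hd : 0 ≤ d) (hd' : 0 ≤ d') :
    edgeProb n τ a d d' = 1 ∨ τ * Real.log n / d * (a / edgeProb n τ a d d') ≤ 1 := by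
  by_cases h : 1 ≤ a * (τ * Real.log n / d)
  · left
    have : sampleProb n τ a d = 1 := min_eq_right h
    rw [edgeProb, this]
    ring
  · right
    have h1 : sampleProb n τ a d = a * (τ * Real.log n / d) := min_eq_left (not_le.1 h).le
    have h2 := sampleProb_le_edgeProb (n := n) (τ := τ) (d := d) ha hd'
    rw [h1] at h2
    rw [← mul_div_assoc, mul_comm (_ / d)]
    exact div_le_one_of_le₀ h2 (edgeProb_nonneg n τ ha hd hd')

end Prob

/-! ### The law of the random graph -/

namespace WGraph

theorem weight_pos {V : Type u} {G : WGraph V} {x y : V} (h : G.w x y ≠ 0) : 0 < G.w x y :=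
  lt_of_le_of_ne (G.nonneg x y) h.symm

theorem measurable_coin {V : Type u} (x y : V) : Measurable fun ω : V → V → I => ω x y := by fun_prop

variable {V : Type u} [Fintype V] (G : WGraph V) (τ : ℝ≥0)

/-- The probability with which the edge `{x, y}` is kept. -/
def keepProb (x y : V) : ℝ := edgeProb (Fintype.card V) τ (G.w x y) (G.deg x) (G.deg y)

/-- The event that the edge `e` is kept. -/
def keptEvent (e : Sym2 V) : Set (V → V → I) := {ω | e ∈ (G.sparsify τ ω).graph.edgeSet}

variable {G τ}

theorem keepProb_comm (x y : V) : G.keepProb τ x y = G.keepProb τ y x := by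
  rw [keepProb, G.symm, edgeProb_comm, keepProb]

theorem keepProb_nonneg (x y : V) : 0 ≤ G.keepProb τ x y :=
  edgeProb_nonneg _ _ (G.nonneg x y) (G.deg_nonneg x) (G.deg_nonneg y)

theorem keepProb_pos (hL : 0 < τ * Real.log (Fintype.card V)) (hd : ∀ x, 0 < G.deg x) {x y : V}
    (h : G.w x y ≠ 0) : 0 < G.keepProb τ x y :=
  edgeProb_pos hL (weight_pos h) (hd x) (hd y)

theorem keepProb_mul_div (hL : 0 < τ * Real.log (Fintype.card V)) (hd : ∀ x, 0 < G.deg x)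
    (x y : V) : G.keepProb τ x y * (G.w x y / G.keepProb τ x y) = G.w x y := by
  by_cases h : G.w x y = 0
  · simp [h]
  · exact mul_div_cancel₀ _ (keepProb_pos hL hd h).ne'

theorem sparsify_graph_le (ω : V → V → I) : (G.sparsify τ ω).graph ≤ G.graph := by
  intro x y h h0
  refine h ?_
  simp [sparsify, h0]

theorem adj_sparsify_iff (hL : 0 < τ * Real.log (Fintype.card V)) (hd : ∀ x, 0 < G.deg x)
    (ω : V → V → I) (x y : V) :
    (G.sparsify τ ω).graph.Adj x y ↔ G.Samples τ ω x y ∨ G.Samples τ ω y x := by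
  constructor
  · intro h
    by_contra h'
    exact h (if_neg h')
  · intro h h0
    have hw : G.w x y ≠ 0 := by
      rcases h with h | h
      · exact h.1
      · rw [G.symm]; exact h.1
    have h1 : (G.sparsify τ ω).w x y = G.w x y / G.keepProb τ x y := if_pos h
    rw [h1] at h0
    exact (div_pos (weight_pos hw) (keepProb_pos hL hd hw)).ne' h0

theorem sparsify_weight_of_adj {ω : V → V → I} {x y : V} (h : (G.sparsify τ ω).graph.Adj x y) :
    (G.sparsify τ ω).w x y = G.w x y / G.keepProb τ x y := by
  have h' : (G.sparsify τ ω).w x y ≠ 0 := h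
  simp only [sparsify] at h' ⊢
  split_ifs at h' ⊢ with h1
  · rfl
  · exact absurd rfl h'

open Classical in
theorem sparsify_weight (ω : V → V → I) (x y : V) :
    (G.sparsify τ ω).w x y =
      if ω ∈ G.keptEvent τ s(x, y) then G.w x y / G.keepProb τ x y else 0 := by
  have hk : ω ∈ G.keptEvent τ s(x, y) ↔ (G.sparsify τ ω).graph.Adj x y :=
    SimpleGraph.mem_edgeSet _
  by_cases h : (G.sparsify τ ω).graph.Adj x y
  · rw [if_pos (hk.2 h), sparsify_weight_of_adj h]
  · rw [if_neg (mt hk.1 h)]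
    exact not_not.1 h

theorem keptEvent_eq_union (hL : 0 < τ * Real.log (Fintype.card V)) (hd : ∀ x, 0 < G.deg x)
    (x y : V) : G.keptEvent τ s(x, y) = {ω | G.Samples τ ω x y} ∪ {ω | G.Samples τ ω y x} := by
  ext ω
  exact (SimpleGraph.mem_edgeSet _).trans (adj_sparsify_iff hL hd ω x y)

theorem measurableSet_comap_samples (x y : V) :
    MeasurableSet[MeasurableSpace.comap (fun ω : V → V → I => ω x y) inferInstance]
      {ω | G.Samples τ ω x y} := by
  by_cases h : G.w x y = 0
  · have : {ω : V → V → I | G.Samples τ ω x y} = ∅ := by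
      ext ω; simp [Samples, h]
    rw [this]
    exact @MeasurableSet.empty _ (MeasurableSpace.comap _ _)
  · refine ⟨{t : I | (t : ℝ) ≤ sampleProb (Fintype.card V) τ (G.w x y) (G.deg x)},
      measurableSet_le measurable_subtype_coe measurable_const, ?_⟩
    ext ω
    simp [Samples, h]

theorem measurableSet_samples (x y : V) : MeasurableSet {ω | G.Samples τ ω x y} :=
  (measurable_coin x y).comap_le _ (measurableSet_comap_samples x y)

theorem iIndepFun_coin :
    iIndepFun (fun (p : V × V) (ω : V → V → I) => ω p.1 p.2) (volume : Measure (V → V → I)) := by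
  have h := iIndepFun_uncurry_infinitePi' (X := fun (_ _ : V) (t : I) => t)
    (fun (_ _ : V) => (volume : Measure I)) (fun _ _ => measurable_id)
  simp only [Measure.infinitePi_eq_pi] at h
  exact h

theorem measureReal_samples (x y : V) :
    (volume : Measure (V → V → I)).real {ω | G.Samples τ ω x y} =
      sampleProb (Fintype.card V) τ (G.w x y) (G.deg x) := by
  by_cases h : G.w x y = 0
  · have : {ω : V → V → I | G.Samples τ ω x y} = ∅ := by
      ext ω; simp [Samples, h]
    rw [this, h, sampleProb_zero, measureReal_empty]
  · set p := sampleProb (Fintype.card V) τ (G.w x y) (G.deg x) with hp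
    have hp0 : 0 ≤ p := sampleProb_nonneg (G.nonneg x y) (G.deg_nonneg x)
    have hp1 : p ≤ 1 := sampleProb_le_one
    have e : {ω : V → V → I | G.Samples τ ω x y} =
        (fun ω => ω x y) ⁻¹' Set.Iic (⟨p, hp0, hp1⟩ : I) := by
      ext ω
      simp [Samples, h, ← hp, ← Subtype.coe_le_coe]
    have h1 : MeasurePreserving (fun ω : V → V → I => ω x y) volume volume :=
      (measurePreserving_eval (fun _ : V => (volume : Measure I)) y).comp
        (measurePreserving_eval (fun _ : V => (volume : Measure (V → I))) x)
    rw [e, measureReal_def, h1.measure_preimage measurableSet_Iic.nullMeasurableSet,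
      unitInterval.volume_Iic, ENNReal.toReal_ofReal hp0]

theorem measurableSet_keptEvent (hL : 0 < τ * Real.log (Fintype.card V))
    (hd : ∀ x, 0 < G.deg x) (e : Sym2 V) : MeasurableSet (G.keptEvent τ e) := by
  induction e with
  | _ x y =>
    rw [keptEvent_eq_union hL hd]
    exact (measurableSet_samples x y).union (measurableSet_samples y x)

/-- Whether `s(x, y)` is kept depends only on the coins at `(x, y)` and `(y, x)`, and distinct
unordered pairs use disjoint sets of coins. -/
theorem iIndepSet_keptEvent (hL : 0 < τ * Real.log (Fintype.card V))
    (hd : ∀ x, 0 < G.deg x) :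
    iIndepSet (G.keptEvent τ) (volume : Measure (V → V → I)) := by
  refine iIndepFun.iIndepSet_of_blocks iIndepFun_coin (fun p => measurable_coin p.1 p.2)
    (fun p => s(p.1, p.2)) fun e => ?_
  induction e with
  | _ x y =>
    rw [keptEvent_eq_union hL hd]
    have h : ∀ x' y', s(x', y') = s(x, y) →
        MeasurableSet[⨆ p ∈ (fun p : V × V => s(p.1, p.2)) ⁻¹' {s(x, y)},
          MeasurableSpace.comap (fun ω : V → V → I => ω p.1 p.2) inferInstance]
          {ω | G.Samples τ ω x' y'} := fun x' y' h =>
      le_iSup₂_of_le (f := fun (p : V × V) (_ : p ∈ (fun p : V × V => s(p.1, p.2)) ⁻¹' {s(x, y)}) =>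
          MeasurableSpace.comap (fun ω : V → V → I => ω p.1 p.2) inferInstance) (x', y') h le_rfl _
        (measurableSet_comap_samples x' y')
    exact @MeasurableSet.union _ (⨆ p ∈ (fun p : V × V => s(p.1, p.2)) ⁻¹' {s(x, y)},
          MeasurableSpace.comap (fun ω : V → V → I => ω p.1 p.2) inferInstance) _ _
        (h x y rfl) (h y x Sym2.eq_swap)

theorem measureReal_keptEvent (hL : 0 < τ * Real.log (Fintype.card V))
    (hd : ∀ x, 0 < G.deg x) (x y : V) :
    (volume : Measure (V → V → I)).real (G.keptEvent τ s(x, y)) = G.keepProb τ x y := by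
  rw [keptEvent_eq_union hL hd]
  -- On the diagonal the two coins coincide and are not independent, but loops have weight 0.
  -- Elsewhere inclusion-exclusion gives `edgeProb`.
  rcases eq_or_ne x y with rfl | hxy
  · rw [Set.union_self, measureReal_samples, keepProb, G.loopless, sampleProb_zero, edgeProb_zero]
  have hind : IndepFun (fun ω : V → V → I => ω x y) (fun ω => ω y x) volume :=
    iIndepFun_coin.indepFun (i := (x, y)) (j := (y, x)) (fun h => hxy (Prod.ext_iff.1 h).1)
  have hm := (Indep_iff _ _ _).1 hind _ _ (measurableSet_comap_samples (G := G) (τ := τ) x y)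
    (measurableSet_comap_samples (G := G) (τ := τ) y x)
  have hm' : (volume : Measure (V → V → I)).real
      ({ω | G.Samples τ ω x y} ∩ {ω | G.Samples τ ω y x}) =
      (volume : Measure (V → V → I)).real {ω | G.Samples τ ω x y} *
      (volume : Measure (V → V → I)).real {ω | G.Samples τ ω y x} := by
    simp only [measureReal_def, hm, ENNReal.toReal_mul]
  have hu := measureReal_union_add_inter (μ := (volume : Measure (V → V → I)))
    (s := {ω | G.Samples τ ω x y}) (measurableSet_samples (G := G) (τ := τ) y x)
  rw [hm', measureReal_samples, measureReal_samples, G.symm y x] at hu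
  rw [keepProb, edgeProb]
  linarith

end WGraph

/-! ### Correctness and cost of the distributed algorithm -/

section Algorithm

variable {V : Type u} [Fintype V] (G : WGraph V) (τ : ℝ≥0) (ω : V → V → I)

theorem sparsifyAlg_exec_one (x : V) :
    (sparsifyAlg V τ).exec G ω 1 x =
      { time := 1
        row := G.w x
        sampled := fun y => decide (G.Samples τ ω x y)
        nbrDeg := fun y => if G.Samples τ ω y x then some (G.deg y) else none } := by
  simp only [DistAlg.exec, sparsifyAlg, DistAlg.msg]
  congr 1
  funext y
  by_cases h : G.w y x = 0
  · simp [h, WGraph.Samples]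
  · by_cases h' : (ω y x : ℝ) ≤ sampleProb (Fintype.card V) τ (G.w y x) (∑ z, G.w y z)
    · simp [h, h', WGraph.Samples, WGraph.deg]
    · simp [h, h', WGraph.Samples, WGraph.deg]

theorem sparsifyAlg_exec_two (x : V) :
    (sparsifyAlg V τ).exec G ω 2 x =
      { time := 2
        row := G.w x
        sampled := fun y => decide (G.Samples τ ω x y)
        nbrDeg := fun y =>
          if G.Samples τ ω x y ∨ G.Samples τ ω y x then some (G.deg y) else none } := by
  rw [DistAlg.exec]
  simp only [sparsifyAlg_exec_one, DistAlg.msg]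
  simp only [sparsifyAlg]
  congr 1
  funext y
  by_cases h : G.w y x = 0
  · have h' : G.w x y = 0 := by rw [G.symm, h]
    simp [h, h', WGraph.Samples]
  · by_cases h1 : G.Samples τ ω x y <;> by_cases h2 : G.Samples τ ω y x <;>
      simp [h, h1, h2, WGraph.deg]

theorem sparsifyAlg_computes : (sparsifyAlg V τ).Computes G ω 2 (G.sparsify τ ω) := by
  intro x
  rw [sparsifyAlg_exec_two]
  simp only [sparsifyAlg]
  rw [if_neg (by norm_num)]
  congr 1
  funext y
  by_cases h : G.Samples τ ω x y ∨ G.Samples τ ω y x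
  · simp [h, WGraph.sparsify, WGraph.deg]
  · simp [h, WGraph.sparsify]

open Classical in
theorem sparsifyAlg_words_le :
    (sparsifyAlg V τ).words G ω 2 ≤ 2 * ∑ x, ∑ y, if G.Samples τ ω x y then 1 else 0 := by
  rw [DistAlg.words, Finset.sum_range_succ, Finset.sum_range_one, two_mul]
  refine add_le_add ?_ ?_
  · refine Finset.sum_le_sum fun x _ => Finset.sum_le_sum fun y _ => ?_
    simp only [DistAlg.msg, DistAlg.exec, sparsifyAlg]
    by_cases h : G.w x y = 0
    · simp [h]
    · by_cases h' : (ω x y : ℝ) ≤ sampleProb (Fintype.card V) τ (G.w x y) (∑ z, G.w x z)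
      · simp [h, h', WGraph.Samples, WGraph.deg]
      · simp [h, h', WGraph.Samples, WGraph.deg]
  -- A word sent in the second round answers one received in the first, so it is charged to the
  -- sample of the other endpoint.
  · rw [Finset.sum_comm]
    refine Finset.sum_le_sum fun x _ => Finset.sum_le_sum fun y _ => ?_
    simp only [DistAlg.msg, sparsifyAlg_exec_one]
    simp only [sparsifyAlg]
    by_cases h : G.w y x = 0
    · simp [h]
    · by_cases h1 : G.Samples τ ω x y <;> by_cases h2 : G.Samples τ ω y x <;> simp [h, h1, h2]

open Classical in
theorem WGraph.ncard_edgeSet_sparsify_le :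
    (G.sparsify τ ω).graph.edgeSet.ncard ≤ ∑ x, ∑ y, if G.Samples τ ω x y then 1 else 0 := by
  have hsub : (G.sparsify τ ω).graph.edgeSet ⊆
      (fun p : V × V => s(p.1, p.2)) ''
        ((Finset.univ.filter fun p : V × V => G.Samples τ ω p.1 p.2 : Finset (V × V)) :
          Set (V × V)) := by
    intro e
    induction e with
    | _ x y =>
      intro h
      have h1 : (G.sparsify τ ω).w x y ≠ 0 := (SimpleGraph.mem_edgeSet _).1 h
      have h2 : G.Samples τ ω x y ∨ G.Samples τ ω y x := by
        by_contra h'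
        exact h1 (if_neg h')
      rcases h2 with h2 | h2
      · exact ⟨(x, y), by simpa using h2, rfl⟩
      · exact ⟨(y, x), by simpa using h2, Sym2.eq_swap⟩
  refine (Set.ncard_le_ncard hsub (Set.toFinite _)).trans ((Set.ncard_image_le
    (Set.toFinite _)).trans ?_)
  rw [Set.ncard_coe_finset, Finset.card_filter, ← Fintype.sum_prod_type']

end Algorithm

/-! ### Moments of the sample count, the cuts, the degrees and the energy -/

/-- A symmetric double sum with zero diagonal is twice the sum over the ordered pairs. -/
theorem sum_sum_eq_two_mul_sum_lt {V : Type*} [Fintype V] {m : ℕ} (f : V ≃ Fin m) (F : V → V → ℝ)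
    (hs : ∀ x y, F x y = F y x) (h0 : ∀ x, F x x = 0) :
    ∑ x, ∑ y, F x y = 2 * ∑ q : {q : V × V // f q.1 < f q.2}, F q.1.1 q.1.2 := by
  have e1 : ∑ q : {q : V × V // f q.1 < f q.2}, F q.1.1 q.1.2 =
      ∑ x, ∑ y, if f x < f y then F x y else 0 := by
    rw [← Fintype.sum_prod_type' (f := fun x y => if f x < f y then F x y else 0),
      ← Finset.sum_filter]
    exact (Finset.sum_subtype (Finset.univ.filter fun q : V × V => f q.1 < f q.2)
      (by simp) (fun q => F q.1 q.2)).symm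
  have e2 : ∑ x, ∑ y, (if f x < f y then F x y else 0) =
      ∑ x, ∑ y, if f y < f x then F x y else 0 := by
    rw [Finset.sum_comm]
    exact Finset.sum_congr rfl fun x _ => Finset.sum_congr rfl fun y _ => by rw [hs]
  rw [e1, two_mul]
  nth_rewrite 2 [e2]
  simp only [← Finset.sum_add_distrib]
  refine Finset.sum_congr rfl fun x _ => Finset.sum_congr rfl fun y _ => ?_
  rcases lt_trichotomy (f x) (f y) with h | h | h
  · simp [h, h.not_gt]
  · rw [f.injective h]
    simp [h0]
  · simp [h, h.not_gt]

open Classical in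
theorem integral_ite_mem {Ω : Type*} [MeasurableSpace Ω] {μ : Measure Ω} {A : Set Ω}
    (hA : MeasurableSet A) (c : ℝ) : ∫ ω, (if ω ∈ A then c else 0) ∂μ = μ.real A * c := by
  have : (fun ω => if ω ∈ A then c else 0) = A.indicator fun _ => c := by
    ext ω; simp [Set.indicator_apply]
  rw [this, integral_indicator_const c hA, smul_eq_mul]

open Classical in
theorem integrable_ite_mem {Ω : Type*} [MeasurableSpace Ω] {μ : Measure Ω} [IsFiniteMeasure μ]
    {A : Set Ω} (hA : MeasurableSet A) (c : ℝ) :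
    Integrable (fun ω => if ω ∈ A then c else 0) μ := by
  have : (fun ω => if ω ∈ A then c else 0) = A.indicator fun _ => c := by
    ext ω; simp [Set.indicator_apply]
  rw [this]
  exact (integrable_const c).indicator hA

namespace WGraph

open Matrix

variable {V : Type u} [Fintype V] {G : WGraph V} {τ : ℝ≥0}

variable (G τ) in
/-- The event that `x` samples the edge to `y`. -/
def sampleEvent (x y : V) : Set (V → V → I) := {ω | G.Samples τ ω x y}

theorem measurableSet_sampleEvent (x y : V) : MeasurableSet (G.sampleEvent τ x y) :=
  measurableSet_samples x y

open Classical in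
theorem integral_sum_samples_le (hd : ∀ x, 0 < G.deg x) :
    ∫ ω, (∑ x, ∑ y, if ω ∈ G.sampleEvent τ x y then (1 : ℝ) else 0) ≤
      Fintype.card V * τ * Real.log (Fintype.card V) := by
  rw [integral_finsetSum _ fun x _ => integrable_finsetSum _ fun y _ =>
    integrable_ite_mem (measurableSet_sampleEvent x y) 1]
  have h : ∀ x, ∫ ω, (∑ y, if ω ∈ G.sampleEvent τ x y then (1 : ℝ) else 0) ≤
      τ * Real.log (Fintype.card V) := fun x => by
    rw [integral_finsetSum _ fun y _ => integrable_ite_mem (measurableSet_sampleEvent x y) 1]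
    calc _ = ∑ y, sampleProb (Fintype.card V) τ (G.w x y) (G.deg x) :=
          Finset.sum_congr rfl fun y _ => by
            rw [integral_ite_mem (measurableSet_sampleEvent x y), mul_one]
            exact measureReal_samples x y
      _ ≤ ∑ y, G.w x y * (τ * Real.log (Fintype.card V) / G.deg x) :=
          Finset.sum_le_sum fun y _ => min_le_left _ _
      _ = _ := by
          rw [← Finset.sum_mul]
          exact mul_div_cancel₀ _ (hd x).ne'
  refine (Finset.sum_le_sum fun x _ => h x).trans (le_of_eq ?_)
  simp [mul_assoc]

theorem integrable_comp_sparsify (hL : 0 < τ * Real.log (Fintype.card V))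
    (hd : ∀ x, 0 < G.deg x) (F : (V → V → ℝ) → ℝ) :
    Integrable (fun ω : V → V → I => F (G.sparsify τ ω).w) := by
  classical
  have e : (fun ω : V → V → I => F (G.sparsify τ ω).w) = fun ω =>
      (fun P : Sym2 V → Prop => F fun x y => if P s(x, y) then G.w x y / G.keepProb τ x y else 0)
        fun e => ω ∈ G.keptEvent τ e := by
    funext ω
    congr 1
    funext x y
    rw [sparsify_weight]
  rw [e]
  exact integrable_comp_mem (A := G.keptEvent τ) (measurableSet_keptEvent hL hd)
    fun P => F fun x y => if P s(x, y) then G.w x y / G.keepProb τ x y else 0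

theorem integral_sparsify_weight (hL : 0 < τ * Real.log (Fintype.card V))
    (hd : ∀ x, 0 < G.deg x) (x y : V) :
    ∫ ω, (G.sparsify τ ω).w x y = G.w x y := by
  classical
  simp only [sparsify_weight]
  rw [integral_ite_mem (measurableSet_keptEvent hL hd _), measureReal_keptEvent hL hd,
    keepProb_mul_div hL hd]

theorem integral_sparsify_cut [DecidableEq V] (hL : 0 < τ * Real.log (Fintype.card V))
    (hd : ∀ x, 0 < G.deg x) (S : Finset V) :
    ∫ ω, (G.sparsify τ ω).cut S = G.cut S := by
  simp only [cut]
  rw [integral_finsetSum _ fun x _ => integrable_finsetSum _ fun y _ =>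
    integrable_comp_sparsify hL hd fun w => w x y]
  refine Finset.sum_congr rfl fun x _ => ?_
  rw [integral_finsetSum _ fun y _ => integrable_comp_sparsify hL hd fun w => w x y]
  exact Finset.sum_congr rfl fun y _ => integral_sparsify_weight hL hd x y

theorem sparsify_cut_eq_zero [DecidableEq V] {S : Finset V} (h : G.cut S = 0) (ω : V → V → I) :
    (G.sparsify τ ω).cut S = 0 := by
  refine Finset.sum_eq_zero fun x hx => Finset.sum_eq_zero fun y hy => ?_
  have h1 := (Finset.sum_eq_zero_iff_of_nonneg fun x _ =>
    Finset.sum_nonneg fun y _ => G.nonneg x y).1 h x hx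
  have h2 := (Finset.sum_eq_zero_iff_of_nonneg fun y _ => G.nonneg x y).1 h1 y hy
  simp [sparsify, h2]

/-- `b y` is the deterministic compensation for the edge to `y`; with it every edge has exponential
mean at most 1, and independence multiplies these means. -/
theorem integral_exp_sum_le (hL : 0 < τ * Real.log (Fintype.card V)) (hd : ∀ x, 0 < G.deg x)
    (x : V) (a b : V → ℝ)
    (h : ∀ y, G.keepProb τ x y * Real.exp (a y + b y) + (1 - G.keepProb τ x y) * Real.exp (b y) ≤ 1)
    (X : (V → V → I) → ℝ)
    (hX : ∀ ω, X ω = ∑ y, @ite ℝ (ω ∈ G.keptEvent τ s(x, y)) (Classical.propDecidable _)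
      (a y + b y) (b y)) :
    ∫ ω, Real.exp (X ω) ≤ 1 := by
  classical
  have hinj : Function.Injective fun y : V => s(x, y) := fun y z hyz => Sym2.congr_right.1 hyz
  have key := integral_sum_ite_le (μ := (volume : Measure (V → V → I)))
    ((iIndepSet_keptEvent hL hd).precomp (s := G.keptEvent τ) hinj) (fun y => measurableSet_keptEvent hL hd _) ⊤
    Real.exp (fun y => a y + b y) b (fun _ => trivial) (fun _ => trivial) (fun y t _ => by
      have e : (volume : Measure (V → V → I)).real
          (((fun e => G.keptEvent τ e) ∘ fun y : V => s(x, y)) y) = G.keepProb τ x y :=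
        measureReal_keptEvent hL hd x y
      rw [e, Real.exp_add, Real.exp_add t]
      have := mul_le_mul_of_nonneg_left (h y) (Real.exp_pos t).le
      linarith) 0 trivial
  rw [Real.exp_zero] at key
  refine le_trans (le_of_eq ?_) key
  refine integral_congr_ae (ae_of_all _ fun ω => ?_)
  simp only [hX, zero_add, Function.comp]

theorem scaled_weight_div_keepProb (x y : V) :
    G.keepProb τ x y = 1 ∨
      τ * Real.log (Fintype.card V) / G.deg x * (G.w x y / G.keepProb τ x y) ≤ 1 :=
  edgeProb_eq_one_or_div_le (G.nonneg x y) (G.deg_nonneg x) (G.deg_nonneg y)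

theorem scaled_weight_nonneg (x y : V) :
    0 ≤ τ * Real.log (Fintype.card V) / G.deg x * (G.w x y / G.keepProb τ x y) :=
  mul_nonneg (div_nonneg (mul_nonneg τ.2 (Real.log_natCast_nonneg _)) (G.deg_nonneg x))
    (div_nonneg (G.nonneg x y) (keepProb_nonneg x y))

theorem scale_mul_deg (hd : ∀ x, 0 < G.deg x) (x : V) :
    ∑ y, τ * Real.log (Fintype.card V) / G.deg x * G.w x y = τ * Real.log (Fintype.card V) := by
  rw [← Finset.mul_sum]
  exact div_mul_cancel₀ _ (hd x).ne'

theorem integral_exp_sparsify_deg_le (hL : 0 < τ * Real.log (Fintype.card V))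
    (hd : ∀ x, 0 < G.deg x) (x : V) :
    ∫ ω, Real.exp (τ * Real.log (Fintype.card V) / G.deg x * (G.sparsify τ ω).deg x -
      2 * (τ * Real.log (Fintype.card V))) ≤ 1 := by
  set θ := τ * Real.log (Fintype.card V) / G.deg x with hθ
  refine integral_exp_sum_le hL hd x (fun y => θ * (G.w x y / G.keepProb τ x y))
    (fun y => -(2 * (θ * G.w x y))) (fun y => ?_) _ (fun ω => ?_)
  · have h := mul_exp_add_le_exp (keepProb_nonneg (τ := τ) x y) edgeProb_le_one
      (scaled_weight_nonneg (G := G) x y) (scaled_weight_div_keepProb x y)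
    rw [← hθ, mul_left_comm (G.keepProb τ x y) θ, keepProb_mul_div hL hd] at h
    have h2 := mul_le_mul_of_nonneg_right h (Real.exp_pos (-(2 * (θ * G.w x y)))).le
    rw [← Real.exp_add, add_neg_cancel, Real.exp_zero] at h2
    rw [Real.exp_add]
    linarith
  · rw [← scale_mul_deg hd x, ← hθ, deg, Finset.mul_sum, Finset.mul_sum, ← Finset.sum_sub_distrib]
    refine Finset.sum_congr rfl fun y _ => ?_
    rw [sparsify_weight]
    split_ifs <;> ring

theorem integral_exp_neg_sparsify_deg_le (hL : 0 < τ * Real.log (Fintype.card V))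
    (hd : ∀ x, 0 < G.deg x) (x : V) :
    ∫ ω, Real.exp (τ * Real.log (Fintype.card V) / 2 -
      τ * Real.log (Fintype.card V) / G.deg x * (G.sparsify τ ω).deg x) ≤ 1 := by
  set θ := τ * Real.log (Fintype.card V) / G.deg x with hθ
  refine integral_exp_sum_le hL hd x (fun y => -(θ * (G.w x y / G.keepProb τ x y)))
    (fun y => θ * G.w x y / 2) (fun y => ?_) _ (fun ω => ?_)
  · have h := mul_exp_neg_add_le_exp (keepProb_nonneg (τ := τ) x y) edgeProb_le_one
      (scaled_weight_nonneg (G := G) x y) (scaled_weight_div_keepProb x y)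
    rw [← hθ, mul_left_comm (G.keepProb τ x y) θ, keepProb_mul_div hL hd] at h
    have h2 := mul_le_mul_of_nonneg_right h (Real.exp_pos (θ * G.w x y / 2)).le
    rw [← Real.exp_add, neg_add_cancel, Real.exp_zero] at h2
    rw [Real.exp_add]
    linarith
  · rw [← scale_mul_deg hd x, ← hθ, deg, Finset.mul_sum, Finset.sum_div, ← Finset.sum_sub_distrib]
    refine Finset.sum_congr rfl fun y _ => ?_
    rw [sparsify_weight]
    split_ifs <;> ring

/-- The exponential moment bound for the smallest eigenvalue of the sparsified Laplacian relative to
the original one. -/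
theorem exists_exp_energy_le (hL : 0 < τ * Real.log (Fintype.card V)) (hd : ∀ x, 0 < G.deg x) :
    ∃ T : (V → V → I) → ℝ, Integrable T ∧ (∀ ω, 0 ≤ T ω) ∧ ∫ ω, T ω ≤ Fintype.card V ∧
      ∀ ω, ∀ z : V → ℝ, ∑ x, G.deg x * z x ^ 2 = 1 →
        Real.exp (τ * Real.log (Fintype.card V) / 2 *
          (G.energy z / 2 - (G.sparsify τ ω).energy z)) ≤ T ω := by
  classical
  set θ := τ * Real.log (Fintype.card V) / 2 with hθ
  let f := Fintype.equivFin V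
  let E := {q : V × V // f q.1 < f q.2}
  have hne : ∀ q : E, q.1.1 ≠ q.1.2 := fun q h => by
    have := q.2
    rw [h] at this
    exact lt_irrefl _ this
  -- `N q` is the squared norm of the difference of the two scaled unit vectors that belong to the
  -- edge, so `v q` is a unit vector and the edge is a multiple of `vecMulVec (v q) (v q)`.
  let N : E → ℝ := fun q => 1 / G.deg q.1.1 + 1 / G.deg q.1.2
  have hN : ∀ q, 0 < N q := fun q => add_pos (one_div_pos.2 (hd _)) (one_div_pos.2 (hd _))
  let v : E → V → ℝ := fun q => (1 / √(N q)) •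
    (Pi.single q.1.1 (1 / √(G.deg q.1.1)) - Pi.single q.1.2 (1 / √(G.deg q.1.2)))
  have hv : ∀ q, ∀ g : V → ℝ, v q ⬝ᵥ g =
      1 / √(N q) * (g q.1.1 / √(G.deg q.1.1) - g q.1.2 / √(G.deg q.1.2)) := fun q g => by
    simp only [v, smul_dotProduct, sub_dotProduct, single_dotProduct, smul_eq_mul]
    ring
  have hvv : ∀ q, v q ⬝ᵥ v q = 1 := fun q => by
    rw [hv]
    have h1 : v q q.1.1 = 1 / √(N q) * (1 / √(G.deg q.1.1)) := by
      simp [v, hne q]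
    have h2 : v q q.1.2 = -(1 / √(N q) * (1 / √(G.deg q.1.2))) := by
      simp [v, (hne q).symm]
    have s1 := Real.sq_sqrt (hN q).le
    have s2 := Real.sq_sqrt (hd q.1.1).le
    have s3 := Real.sq_sqrt (hd q.1.2).le
    have e : 1 / √(N q) * (v q q.1.1 / √(G.deg q.1.1) - v q q.1.2 / √(G.deg q.1.2)) =
        1 / √(N q) ^ 2 * (1 / √(G.deg q.1.1) ^ 2 + 1 / √(G.deg q.1.2) ^ 2) := by
      rw [h1, h2]; ring
    rw [e, s1, s2, s3]
    exact one_div_mul_cancel (hN q).ne'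
  have hvz : ∀ q, ∀ z : V → ℝ, v q ⬝ᵥ (fun x => √(G.deg x) * z x) =
      1 / √(N q) * (z q.1.1 - z q.1.2) := fun q z => by
    have s2 := (Real.sqrt_pos.2 (hd q.1.1)).ne'
    have s3 := (Real.sqrt_pos.2 (hd q.1.2)).ne'
    rw [hv, mul_div_cancel_left₀ _ s2, mul_div_cancel_left₀ _ s3]
  let p : E → ℝ := fun q => G.keepProb τ q.1.1 q.1.2
  let r : E → ℝ := fun q => G.w q.1.1 q.1.2 / p q
  let a : E → ℝ := fun q => θ * r q * N q
  have hr : ∀ q, 0 ≤ r q := fun q => div_nonneg (G.nonneg _ _) (keepProb_nonneg _ _)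
  have hθ0 : 0 < θ := by positivity
  have ha0 : ∀ q, 0 ≤ a q := fun q => mul_nonneg (mul_nonneg hθ0.le (hr q)) (hN q).le
  -- The factor 1/2 in `θ` makes `a q` the average of the scaled weights seen from the two
  -- endpoints.
  have ha1 : ∀ q, p q = 1 ∨ a q ≤ 1 := fun q => by
    rcases scaled_weight_div_keepProb (G := G) (τ := τ) q.1.1 q.1.2 with h1 | h1
    · exact Or.inl h1
    rcases scaled_weight_div_keepProb (G := G) (τ := τ) q.1.2 q.1.1 with h2 | h2
    · exact Or.inl ((keepProb_comm _ _).trans h2)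
    right
    rw [keepProb_comm, G.symm] at h2
    have e : a q = (τ * Real.log (Fintype.card V) / G.deg q.1.1 * r q +
        τ * Real.log (Fintype.card V) / G.deg q.1.2 * r q) / 2 := by
      simp only [a, N, hθ]; ring
    rw [e]
    have h1' : τ * Real.log (Fintype.card V) / G.deg q.1.1 * r q ≤ 1 := h1
    have h2' : τ * Real.log (Fintype.card V) / G.deg q.1.2 * r q ≤ 1 := h2
    linarith
  let A : E → Set (V → V → I) := fun q => G.keptEvent τ s(q.1.1, q.1.2)
  have hinj : Function.Injective fun q : E => s(q.1.1, q.1.2) := fun q q' h => by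
    rcases Sym2.eq_iff.1 h with h | h
    · exact Subtype.ext (Prod.ext h.1 h.2)
    · have h1 := q.2
      have h2 := q'.2
      rw [h.1, h.2] at h1
      exact absurd h1 h2.not_gt
  have hAi : iIndepSet A (volume : Measure (V → V → I)) :=
    (iIndepSet_keptEvent hL hd).precomp (s := G.keptEvent τ) hinj
  have hAm : ∀ q, MeasurableSet (A q) := fun q => measurableSet_keptEvent hL hd _
  have hAp : ∀ q, (volume : Measure (V → V → I)).real (A q) = p q := fun q =>
    measureReal_keptEvent hL hd _ _
  let P : E → Matrix V V ℝ := fun q => vecMulVec (v q) (v q)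
  -- The trace inequality holds for symmetric matrices only, so the walk is confined to this
  -- subgroup.
  let Q : AddSubgroup (Matrix V V ℝ) := selfAdjoint (Matrix V V ℝ)
  have hQ : ∀ M ∈ Q, M.IsHermitian := fun M hM => hM
  have hPQ : ∀ (c : ℝ) q, c • P q ∈ Q := fun c q =>
    (isHermitian_vecMulVec_self (v q)).smul_real c
  let α : E → Matrix V V ℝ := fun q => (-a q + p q * a q / 2) • P q
  let β : E → Matrix V V ℝ := fun q => (p q * a q / 2) • P q
  let M : (V → V → I) → Matrix V V ℝ := fun ω => 0 + ∑ q, if ω ∈ A q then α q else β q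
  have hM : ∀ ω, (M ω).IsHermitian := fun ω => by
    refine hQ _ (Q.add_mem Q.zero_mem (Q.sum_mem fun q _ => ?_))
    split_ifs
    · exact hPQ _ q
    · exact hPQ _ q
  refine ⟨fun ω => (NormedSpace.exp (M ω)).trace, ?_, fun ω => (hM ω).trace_exp_nonneg, ?_, ?_⟩
  · exact integrable_comp_mem hAm fun B : E → Prop =>
      (NormedSpace.exp (0 + ∑ q, if B q then α q else β q)).trace
  · have key := integral_sum_ite_le hAi hAm Q (fun X => (NormedSpace.exp X).trace) α β
      (fun q => hPQ _ q) (fun q => hPQ _ q) (fun q X hX => by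
        rw [hAp]
        refine (hQ X hX).trace_exp_add_smul_vecMulVec_mean_le (hvv q) (keepProb_nonneg _ _)
          edgeProb_le_one ?_
        have h := mul_exp_neg_add_le_exp (keepProb_nonneg _ _) edgeProb_le_one (ha0 q) (ha1 q)
        have h2 := mul_le_mul_of_nonneg_right h (Real.exp_pos (p q * a q / 2)).le
        rw [← Real.exp_add, neg_add_cancel, Real.exp_zero] at h2
        rw [Real.exp_add]
        linarith) 0 Q.zero_mem
    refine le_trans (le_of_eq rfl) (key.trans (le_of_eq ?_))
    -- The walk starts at the zero matrix, whose exponential has trace `Fintype.card V`.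
    simp
  · intro ω z hz
    have h1 := (hM ω).exp_dotProduct_le_trace_exp (v := fun x => √(G.deg x) * z x)
      ((dotProduct_sqrt_deg G z).trans hz)
    refine le_trans (le_of_eq ?_) h1
    congr 1
    have hquad : ∀ (c : ℝ) q, (fun x => √(G.deg x) * z x) ⬝ᵥ (c • P q) *ᵥ
        (fun x => √(G.deg x) * z x) = c / N q * (z q.1.1 - z q.1.2) ^ 2 := fun c q => by
      rw [smul_mulVec, dotProduct_smul, vecMulVec_mulVec, hvz]
      simp only [smul_eq_mul, MulOpposite.smul_eq_mul_unop, dotProduct_smul, MulOpposite.unop_op]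
      rw [dotProduct_comm, hvz]
      have s1 := Real.sq_sqrt (hN q).le
      have : 1 / √(N q) * (z q.1.1 - z q.1.2) * (1 / √(N q) * (z q.1.1 - z q.1.2)) =
        1 / √(N q) ^ 2 * (z q.1.1 - z q.1.2) ^ 2 := by ring
      rw [this, s1]
      ring
    have hpr : ∀ q, p q * r q = G.w q.1.1 q.1.2 := fun q => keepProb_mul_div hL hd _ _
    have hc : ∀ q, (fun x => √(G.deg x) * z x) ⬝ᵥ (if ω ∈ A q then α q else β q) *ᵥ
        (fun x => √(G.deg x) * z x) = θ * (G.w q.1.1 q.1.2 / 2 - (G.sparsify τ ω).w q.1.1 q.1.2) *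
          (z q.1.1 - z q.1.2) ^ 2 := fun q => by
      have e1 : p q * a q / 2 / N q = θ * (G.w q.1.1 q.1.2 / 2) := by
        rw [← hpr]
        simp only [a]
        field_simp [(hN q).ne']
      have e2 : a q / N q = θ * r q := mul_div_cancel_right₀ _ (hN q).ne'
      rw [sparsify_weight]
      by_cases h : ω ∈ A q
      · rw [if_pos h, if_pos h, hquad, add_div, neg_div, e1, e2]
        ring
      · rw [if_neg h, if_neg h, hquad, e1]
        ring
    have hsum : ∀ H : WGraph V, H.energy z =
        ∑ q : E, H.w q.1.1 q.1.2 * (z q.1.1 - z q.1.2) ^ 2 := fun H => by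
      rw [energy, sum_sum_eq_two_mul_sum_lt f (fun x y => H.w x y * (z x - z y) ^ 2)
        (fun x y => by rw [H.symm]; ring) (fun x => by simp)]
      exact mul_div_cancel_left₀ _ two_ne_zero
    simp only [M]
    rw [zero_add, sum_mulVec, dotProduct_sum, Finset.sum_congr rfl fun q _ => hc q, hsum G,
      hsum (G.sparsify τ ω), Finset.sum_div, ← Finset.sum_sub_distrib, Finset.mul_sum]
    exact Finset.sum_congr rfl fun q _ => by ring

end WGraph

/-! ### From the moment bounds to conductances and gaps -/

theorem log_thousand_mul_le {n : ℕ} (hn : 2 ≤ n) :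
    Real.log (1000 * n) ≤ 11 * Real.log n := by
  have h2 : (2 : ℝ) ≤ n := by exact_mod_cast hn
  rw [show (11 : ℝ) * Real.log n = Real.log ((n : ℝ) ^ 11) by rw [Real.log_pow]; norm_num]
  refine Real.log_le_log (by positivity) ?_
  -- `1000 ≤ 2 ^ 10` is the origin of the constant 11.
  have h10 : (2 : ℝ) ^ 10 ≤ (n : ℝ) ^ 10 := pow_le_pow_left₀ (by norm_num) h2 10
  calc (1000 * n : ℝ) ≤ (n : ℝ) ^ 10 * n :=
        mul_le_mul_of_nonneg_right (by linarith) (by positivity)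
    _ = (n : ℝ) ^ 11 := by ring

theorem le_eleven_log_of_exp_le {n : ℕ} (hn : 2 ≤ n) {t : ℝ} (h : Real.exp t ≤ 1000 * n) :
    t ≤ 11 * Real.log n := by
  refine le_trans ?_ (log_thousand_mul_le hn)
  rw [← Real.log_exp t]
  exact Real.log_le_log (Real.exp_pos t) h

namespace WGraph

variable {V : Type u} [Fintype V] {G H : WGraph V}

theorem energy_smul (c : ℝ) (z : V → ℝ) : G.energy (c • z) = c ^ 2 * G.energy z := by
  rw [energy, energy, mul_div_assoc', Finset.mul_sum]
  congr 1
  refine Finset.sum_congr rfl fun x _ => ?_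
  rw [Finset.mul_sum]
  refine Finset.sum_congr rfl fun y _ => ?_
  simp only [Pi.smul_apply, smul_eq_mul]
  ring

/-- An inequality between energies only has to be checked for normalised vectors. -/
theorem energy_le_of_normalized {ε : ℝ}
    (h : ∀ z : V → ℝ, ∑ x, G.deg x * z x ^ 2 = 1 → G.energy z / 2 - ε ≤ H.energy z) (z : V → ℝ) :
    G.energy z / 2 - ε * ∑ x, G.deg x * z x ^ 2 ≤ H.energy z := by
  set s := ∑ x, G.deg x * z x ^ 2 with hs
  have hs0 : 0 ≤ s := Finset.sum_nonneg fun x _ => mul_nonneg (G.deg_nonneg x) (sq_nonneg _)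
  rcases hs0.eq_or_lt with h0 | h0
  -- A vector of norm 0 cannot be normalised, but its energy in `G` vanishes.
  · have h1 := G.energy_le z
    rw [← hs, ← h0] at h1
    have h2 := H.energy_nonneg z
    rw [← h0]
    linarith
  · have hc : (√s)⁻¹ ^ 2 = s⁻¹ := by rw [inv_pow, Real.sq_sqrt hs0]
    have h1 := h ((√s)⁻¹ • z) (by
      have : ∀ x, G.deg x * ((√s)⁻¹ • z) x ^ 2 = s⁻¹ * (G.deg x * z x ^ 2) := fun x => by
        rw [Pi.smul_apply, smul_eq_mul, mul_pow, hc]; ring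
      simp only [this]
      rw [← Finset.mul_sum, ← hs, inv_mul_cancel₀ h0.ne'])
    rw [energy_smul, energy_smul, hc] at h1
    have h2 := mul_le_mul_of_nonneg_left h1 hs0
    have e1 : s * (s⁻¹ * G.energy z / 2 - ε) = G.energy z / 2 - ε * s := by field_simp
    have e2 : s * (s⁻¹ * H.energy z) = H.energy z := mul_inv_cancel_left₀ h0.ne' _
    rwa [e1, e2] at h2

theorem vol_nonneg (S : Finset V) : 0 ≤ G.vol S := Finset.sum_nonneg fun x _ => G.deg_nonneg x

variable [DecidableEq V]

theorem cut_nonneg (S : Finset V) : 0 ≤ G.cut S :=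
  Finset.sum_nonneg fun x _ => Finset.sum_nonneg fun y _ => G.nonneg x y

theorem conductance_nonneg (S : Finset V) : 0 ≤ G.conductance S :=
  div_nonneg (cut_nonneg S) (vol_nonneg S)

theorem conductance_le_mul {S : Finset V} (hS : S.Nonempty) (hG : ∀ x, 0 < G.deg x) {a b : ℝ}
    (hb : 0 < b) (hcut : H.cut S ≤ a * G.cut S) (hd : ∀ x, b * G.deg x ≤ H.deg x) :
    H.conductance S ≤ a / b * G.conductance S := by
  have hv : 0 < G.vol S := Finset.sum_pos (fun x _ => hG x) hS
  have hvol : b * G.vol S ≤ H.vol S := by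
    rw [vol, vol, Finset.mul_sum]
    exact Finset.sum_le_sum fun x _ => hd x
  have h0 : 0 ≤ a * G.cut S := (cut_nonneg S).trans hcut
  rw [conductance, conductance, div_mul_div_comm]
  exact div_le_div₀ h0 hcut (mul_pos hb hv) hvol

theorem rho_le {k : ℕ} {A : Fin k → Finset V} (hA : IsPartition A) :
    G.rho k ≤ ⨆ i, G.conductance (A i) := by
  refine ciInf_le ⟨0, ?_⟩ (⟨A, hA⟩ : {A : Fin k → Finset V // IsPartition A})
  rintro _ ⟨B, rfl⟩
  exact Real.iSup_nonneg fun i => conductance_nonneg _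

theorem rho_le_mul_rho {k : ℕ} {S : Fin k → Finset V} (hS : G.IsOptimal S) {a : ℝ} (ha : 0 ≤ a)
    (h : ∀ i, H.conductance (S i) ≤ a * G.conductance (S i)) : H.rho k ≤ a * G.rho k := by
  refine (rho_le hS.1).trans ?_
  rw [← hS.2]
  refine Real.iSup_le (fun i => (h i).trans (mul_le_mul_of_nonneg_left ?_ ha))
    (mul_nonneg ha (Real.iSup_nonneg fun i => conductance_nonneg _))
  exact le_ciSup (f := fun i => G.conductance (S i)) (Set.finite_range _).bddAbove i

/-- Only the positive finite factor `b * k` is pulled out of the inverse, so a vanishing `rho` needs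
no separate case. -/
theorem mul_gap_div_le_gap {k : ℕ} (hk : k < Fintype.card V) (hk1 : 1 ≤ k) {a b : ℝ} (ha : 0 < a)
    (hb : 0 < b) (heig : a * G.eig ⟨k, hk⟩ ≤ H.eig ⟨k, hk⟩) (hrho : H.rho k ≤ b * k * G.rho k) :
    ENNReal.ofReal (a / b) * (G.gap k hk / k) ≤ H.gap k hk := by
  have hk0 : (0 : ℝ) < k := by exact_mod_cast hk1
  have hbk : 0 < b * k := mul_pos hb hk0
  have hc : ENNReal.ofReal (b * k) ≠ 0 := (ENNReal.ofReal_pos.2 hbk).ne'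
  refine le_trans (le_of_eq ?_) (ENNReal.div_le_div (ENNReal.ofReal_le_ofReal heig)
    (ENNReal.ofReal_le_ofReal hrho))
  simp only [gap, div_eq_mul_inv]
  rw [ENNReal.ofReal_mul hbk.le, ENNReal.mul_inv (Or.inl hc) (Or.inl ENNReal.ofReal_ne_top),
    ← ENNReal.ofReal_inv_of_pos hbk, ← ENNReal.ofReal_natCast k, ← ENNReal.ofReal_inv_of_pos hk0,
    mul_inv, ENNReal.ofReal_mul (inv_nonneg.2 hb.le), ENNReal.ofReal_mul ha.le,
    ENNReal.ofReal_mul ha.le]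
  ring

end WGraph

end

/-! ### The theorem -/

open WGraph in
theorem theorem1 :
    ∃ C K c : ℝ, 0 < C ∧ 0 < K ∧ 0 < c ∧ ∃ R : ℕ,
      ∀ (V : Type u) [Fintype V] [DecidableEq V] (G : WGraph V) (k : ℕ)
        (hk : k < Fintype.card V) (τ : ℝ≥0) (S : Fin k → Finset V),
        1 ≤ k → (∀ x, 0 < G.deg x) → G.IsOptimal S →
        0 < G.eig ⟨k, hk⟩ → C / G.eig ⟨k, hk⟩ ≤ τ →
        -- every edge is kept independently, with the stated probability, and reweighted
        (∀ ω, (G.sparsify τ ω).graph ≤ G.graph) ∧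
        iIndepSet (fun e : G.graph.edgeSet => {ω | e.1 ∈ (G.sparsify τ ω).graph.edgeSet})
          (volume : Measure (V → V → I)) ∧
        (∀ x y, G.graph.Adj x y →
          (volume : Measure (V → V → I)).real {ω | (G.sparsify τ ω).graph.Adj x y} =
            edgeProb (Fintype.card V) τ (G.w x y) (G.deg x) (G.deg y)) ∧
        (∀ ω x y, (G.sparsify τ ω).graph.Adj x y →
          (G.sparsify τ ω).w x y =
            G.w x y / edgeProb (Fintype.card V) τ (G.w x y) (G.deg x) (G.deg y)) ∧
        -- the distributed algorithm computes this graph in a constant number of rounds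
        (∀ ω, (sparsifyAlg V τ).Computes G ω R (G.sparsify τ ω)) ∧
        -- the guarantees, which hold simultaneously with probability greater than 0.99
        0.99 < (volume : Measure (V → V → I)).real {ω |
          ((G.sparsify τ ω).graph.edgeSet.ncard : ℝ) ≤
              K * (Fintype.card V * τ * Real.log (Fintype.card V)) ∧
          ((sparsifyAlg V τ).words G ω R : ℝ) ≤
              K * (Fintype.card V * τ * Real.log (Fintype.card V)) ∧
          (∀ x, 0 < (G.sparsify τ ω).deg x) ∧
          ENNReal.ofReal c * (G.gap k hk / k) ≤ (G.sparsify τ ω).gap k hk ∧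
          ∀ i, (G.sparsify τ ω).conductance (S i) ≤ K * (k * G.conductance (S i))} := by
  classical
  -- With 88, `τ * λ / 4 ≥ 22` absorbs the error of the energy, and `λ ≤ 2` gives `τ ≥ 44`, so `11 ≤
  -- τ / 4` and all degrees change by factors between 1/4 and 3. Then 4000 is 1000 from Markov
  -- divided by 1/4, and 1/12 is the eigenvalue loss `1 / (4 * 3)`.
  refine ⟨88, 4000, 1 / 12 / 4000, by norm_num, by norm_num, by norm_num, 2, ?_⟩
  intro V _ _ G k hk τ S hk1 hd hS hlam hτ
  set lam := G.eig ⟨k, hk⟩ with hlam_def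
  set n := Fintype.card V with hn_def
  set L := Real.log n with hL_def
  have hn2 : 2 ≤ n := by omega
  have hn0 : (0 : ℝ) < n := by positivity
  have hL0 : 0 < L := Real.log_pos (by exact_mod_cast hn2)
  have hτlam : 88 ≤ τ * lam := (div_le_iff₀ hlam).1 hτ
  have hlam2 : lam ≤ 2 := G.eig_le_two hd hk
  have hτ44 : (44 : ℝ) ≤ τ := by
    by_contra hlt
    have : (τ : ℝ) * lam < 44 * 2 :=
      mul_lt_mul'' (not_le.1 hlt) (lt_of_le_of_ne hlam2 fun h => by
        rw [h] at hτlam; linarith) τ.2 hlam.le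
    linarith
  have hτ0 : (0 : ℝ) < τ := by linarith
  have hk0 : (0 : ℝ) < k := by exact_mod_cast hk1
  have hL : 0 < τ * Real.log (Fintype.card V) := mul_pos hτ0 hL0
  refine ⟨fun ω => sparsify_graph_le ω,
    (iIndepSet_keptEvent hL hd).precomp (s := G.keptEvent τ) Subtype.val_injective,
    fun x y _ => measureReal_keptEvent hL hd x y, fun ω x y h => sparsify_weight_of_adj h,
    fun ω => sparsifyAlg_computes G τ ω, ?_⟩
  obtain ⟨T, hTi, hT0, hTm, hT⟩ := exists_exp_energy_le hL hd
  let f₁ : (V → V → I) → ℝ := fun ω => ∑ x, ∑ y, if ω ∈ G.sampleEvent τ x y then (1 : ℝ) else 0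
  let f₂ : (V → V → I) → ℝ := fun ω => ∑ i, (G.sparsify τ ω).cut (S i) / G.cut (S i)
  let f₃ : (V → V → I) → ℝ := fun ω => ∑ x, Real.exp (τ * L / G.deg x * (G.sparsify τ ω).deg x -
    2 * (τ * L))
  let f₄ : (V → V → I) → ℝ := fun ω => ∑ x, Real.exp (τ * L / 2 -
    τ * L / G.deg x * (G.sparsify τ ω).deg x)
  have b₁ := measureReal_lt_le_of_integral_le (μ := (volume : Measure (V → V → I))) (f := f₁)
    (integrable_finsetSum _ fun x _ => integrable_finsetSum _ fun y _ =>
      integrable_ite_mem (measurableSet_sampleEvent x y) 1)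
    (fun ω => Finset.sum_nonneg fun x _ => Finset.sum_nonneg fun y _ => by split_ifs <;> norm_num)
    (integral_sum_samples_le hd) (by positivity) (by norm_num : (0 : ℝ) < 1000)
  have b₂ := measureReal_lt_le_of_integral_le (μ := (volume : Measure (V → V → I))) (f := f₂)
    (m := k)
    (integrable_comp_sparsify hL hd fun w => ∑ i, (∑ x ∈ S i, ∑ y ∈ (S i)ᶜ, w x y) / G.cut (S i))
    (fun ω => Finset.sum_nonneg fun i _ => div_nonneg (cut_nonneg _) (cut_nonneg _))
    (by
      refine (integral_finsetSum _ fun i _ => (integrable_comp_sparsify hL hd fun w =>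
        (∑ x ∈ S i, ∑ y ∈ (S i)ᶜ, w x y) / G.cut (S i))).le.trans ?_
      refine (Finset.sum_le_sum (g := fun _ => (1 : ℝ)) fun i _ => ?_).trans (by simp)
      have h : ∫ ω, (G.sparsify τ ω).cut (S i) / G.cut (S i) = G.cut (S i) / G.cut (S i) := by
        rw [integral_div, integral_sparsify_cut hL hd]
      exact h.le.trans (div_self_le_one _)) hk0 (by norm_num : (0 : ℝ) < 1000)
  have b₃ := measureReal_lt_le_of_integral_le (μ := (volume : Measure (V → V → I))) (f := f₃)
    (m := n)
    (integrable_comp_sparsify hL hd fun w => ∑ x, Real.exp (τ * L / G.deg x * (∑ y, w x y) -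
      2 * (τ * L)))
    (fun ω => Finset.sum_nonneg fun x _ => (Real.exp_pos _).le)
    (by
      refine (integral_finsetSum _ fun x _ => (integrable_comp_sparsify hL hd fun w =>
        Real.exp (τ * L / G.deg x * (∑ y, w x y) - 2 * (τ * L)))).le.trans ?_
      refine (Finset.sum_le_sum (g := fun _ => (1 : ℝ)) fun x _ => ?_).trans (by simp [n])
      exact integral_exp_sparsify_deg_le hL hd x) hn0 (by norm_num : (0 : ℝ) < 1000)
  have b₄ := measureReal_lt_le_of_integral_le (μ := (volume : Measure (V → V → I))) (f := f₄)
    (m := n)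
    (integrable_comp_sparsify hL hd fun w => ∑ x, Real.exp (τ * L / 2 -
      τ * L / G.deg x * (∑ y, w x y)))
    (fun ω => Finset.sum_nonneg fun x _ => (Real.exp_pos _).le)
    (by
      refine (integral_finsetSum _ fun x _ => (integrable_comp_sparsify hL hd fun w =>
        Real.exp (τ * L / 2 - τ * L / G.deg x * (∑ y, w x y)))).le.trans ?_
      refine (Finset.sum_le_sum (g := fun _ => (1 : ℝ)) fun x _ => ?_).trans (by simp [n])
      exact integral_exp_neg_sparsify_deg_le hL hd x) hn0 (by norm_num : (0 : ℝ) < 1000)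
  have b₅ := measureReal_lt_le_of_integral_le (μ := (volume : Measure (V → V → I))) hTi hT0 hTm
    hn0 (by norm_num : (0 : ℝ) < 1000)
  set B₁ := {ω | 1000 * (n * τ * L) < f₁ ω} with hB₁
  set B₂ := {ω | 1000 * (k : ℝ) < f₂ ω} with hB₂
  set B₃ := {ω | 1000 * (n : ℝ) < f₃ ω} with hB₃
  set B₄ := {ω | 1000 * (n : ℝ) < f₄ ω} with hB₄
  set B₅ := {ω | 1000 * (n : ℝ) < T ω} with hB₅
  set good := {ω | ((G.sparsify τ ω).graph.edgeSet.ncard : ℝ) ≤ 4000 * (n * τ * L) ∧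
    ((sparsifyAlg V τ).words G ω 2 : ℝ) ≤ 4000 * (n * τ * L) ∧
    (∀ x, 0 < (G.sparsify τ ω).deg x) ∧
    ENNReal.ofReal (1 / 12 / 4000) * (G.gap k hk / k) ≤ (G.sparsify τ ω).gap k hk ∧
    ∀ i, (G.sparsify τ ω).conductance (S i) ≤ 4000 * (k * G.conductance (S i))} with hgood
  have cover : (Set.univ : Set (V → V → I)) ⊆ good ∪ (B₁ ∪ (B₂ ∪ (B₃ ∪ (B₄ ∪ B₅)))) := by
    intro ω _
    by_contra hω
    simp only [Set.mem_union, not_or] at hω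
    obtain ⟨hg, h₁, h₂, h₃, h₄, h₅⟩ := hω
    have h₁ : f₁ ω ≤ 1000 * (n * τ * L) := not_lt.1 h₁
    have h₂ : f₂ ω ≤ 1000 * k := not_lt.1 h₂
    have h₃ : f₃ ω ≤ 1000 * n := not_lt.1 h₃
    have h₄ : f₄ ω ≤ 1000 * n := not_lt.1 h₄
    have h₅ : T ω ≤ 1000 * n := not_lt.1 h₅
    have hcount : ((∑ x, ∑ y, if G.Samples τ ω x y then 1 else 0 : ℕ) : ℝ) = f₁ ω := by
      push_cast
      exact Finset.sum_congr rfl fun x _ => Finset.sum_congr rfl fun y _ => by congr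
    have hdlow : ∀ x, 1 / 4 * G.deg x ≤ (G.sparsify τ ω).deg x := fun x => by
      have h := le_eleven_log_of_exp_le hn2 ((Finset.single_le_sum (f := fun x =>
        Real.exp (τ * L / 2 - τ * L / G.deg x * (G.sparsify τ ω).deg x))
        (fun x _ => (Real.exp_pos _).le) (Finset.mem_univ x)).trans h₄)
      rw [← hL_def] at h
      have e : τ * L / G.deg x * (G.sparsify τ ω).deg x =
        L * (τ * ((G.sparsify τ ω).deg x / G.deg x)) := by ring
      have h' : L * (τ / 2 - τ * ((G.sparsify τ ω).deg x / G.deg x)) ≤ L * 11 := by linarith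
      have h'' := le_of_mul_le_mul_left h' hL0
      have h3 : τ * (1 / 4 : ℝ) ≤ τ * ((G.sparsify τ ω).deg x / G.deg x) := by linarith
      exact (le_div_iff₀ (hd x)).1 (le_of_mul_le_mul_left h3 hτ0)
    have hdup : ∀ x, (G.sparsify τ ω).deg x ≤ 3 * G.deg x := fun x => by
      have h := le_eleven_log_of_exp_le hn2 ((Finset.single_le_sum (f := fun x =>
        Real.exp (τ * L / G.deg x * (G.sparsify τ ω).deg x - 2 * (τ * L)))
        (fun x _ => (Real.exp_pos _).le) (Finset.mem_univ x)).trans h₃)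
      rw [← hL_def] at h
      have e : τ * L / G.deg x * (G.sparsify τ ω).deg x =
        L * (τ * ((G.sparsify τ ω).deg x / G.deg x)) := by ring
      have h' : L * (τ * ((G.sparsify τ ω).deg x / G.deg x) - 2 * τ) ≤ L * 11 := by linarith
      have h'' := le_of_mul_le_mul_left h' hL0
      have h3 : τ * ((G.sparsify τ ω).deg x / G.deg x) ≤ τ * 3 := by linarith
      exact (div_le_iff₀ (hd x)).1 (le_of_mul_le_mul_left h3 hτ0)
    have hHpos : ∀ x, 0 < (G.sparsify τ ω).deg x := fun x =>
      lt_of_lt_of_le (mul_pos (by norm_num) (hd x)) (hdlow x)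
    have hcond : ∀ i, (G.sparsify τ ω).conductance (S i) ≤ 4000 * k * G.conductance (S i) :=
      fun i => by
      have hcut : (G.sparsify τ ω).cut (S i) ≤ 1000 * k * G.cut (S i) := by
        -- A cluster without outgoing edges contributes 0 / 0 = 0 to `f₂`, which says nothing about
        -- it; its cut in `H` is 0 as well.
        rcases (cut_nonneg (G := G) (S i)).eq_or_lt with h0 | h0
        · rw [sparsify_cut_eq_zero h0.symm, ← h0, mul_zero]
        · refine (div_le_iff₀ h0).1 (le_trans ?_ h₂)
          exact Finset.single_le_sum (f := fun i => (G.sparsify τ ω).cut (S i) / G.cut (S i))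
            (fun i _ => div_nonneg (cut_nonneg _) (cut_nonneg _)) (Finset.mem_univ i)
      have := conductance_le_mul (hS.1.nonempty i) hd (by norm_num : (0 : ℝ) < 1 / 4) hcut hdlow
      have e : 1000 * (k : ℝ) / (1 / 4) = 4000 * k := by ring
      rwa [e] at this
    have henergy : ∀ z : V → ℝ, G.energy z / 2 - lam / 4 * ∑ x, G.deg x * z x ^ 2 ≤
        (G.sparsify τ ω).energy z := by
      refine energy_le_of_normalized fun z hz => ?_
      have h := le_eleven_log_of_exp_le hn2 ((hT ω z hz).trans h₅)
      rw [← hL_def] at h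
      have h' : L * (τ * (G.energy z / 2 - (G.sparsify τ ω).energy z)) ≤ L * 22 := by linarith
      have h'' := le_of_mul_le_mul_left h' hL0
      have h3 : τ * (G.energy z / 2 - (G.sparsify τ ω).energy z) ≤ τ * (lam / 4) := by linarith
      have := le_of_mul_le_mul_left h3 hτ0
      linarith
    have heig := eig_div_le_eig G (G.sparsify τ ω) hd hHpos hk hlam (by norm_num : (0 : ℝ) < 3)
      hdup henergy
    have hnL : 0 ≤ n * τ * L := by positivity
    refine hg ⟨?_, ?_, hHpos, ?_, fun i => by rw [← mul_assoc]; exact hcond i⟩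
    · have h : ((G.sparsify τ ω).graph.edgeSet.ncard : ℝ) ≤
          ((∑ x, ∑ y, if G.Samples τ ω x y then 1 else 0 : ℕ) : ℝ) := by
        exact_mod_cast (ncard_edgeSet_sparsify_le G τ ω).trans
          (le_of_eq (Finset.sum_congr rfl fun x _ => Finset.sum_congr rfl fun y _ => by congr))
      linarith
    · have h : ((sparsifyAlg V τ).words G ω 2 : ℝ) ≤
          2 * ((∑ x, ∑ y, if G.Samples τ ω x y then 1 else 0 : ℕ) : ℝ) := by
        exact_mod_cast (sparsifyAlg_words_le G τ ω).trans
          (le_of_eq (congrArg _ (Finset.sum_congr rfl fun x _ =>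
            Finset.sum_congr rfl fun y _ => by congr)))
      linarith
    · refine mul_gap_div_le_gap hk hk1 (by norm_num) (by norm_num) (le_trans (le_of_eq ?_) heig)
        (rho_le_mul_rho hS (by positivity) hcond)
      ring
  have h1 : (1 : ℝ) ≤ (volume : Measure (V → V → I)).real good +
      ((volume : Measure (V → V → I)).real B₁ + ((volume : Measure (V → V → I)).real B₂ +
      ((volume : Measure (V → V → I)).real B₃ + ((volume : Measure (V → V → I)).real B₄ +
      (volume : Measure (V → V → I)).real B₅)))) := by
    rw [← probReal_univ (μ := (volume : Measure (V → V → I)))]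
    refine (measureReal_mono cover).trans ((measureReal_union_le _ _).trans (add_le_add_right ?_ _))
    refine (measureReal_union_le _ _).trans (add_le_add_right ?_ _)
    refine (measureReal_union_le _ _).trans (add_le_add_right ?_ _)
    refine (measureReal_union_le _ _).trans (add_le_add_right ?_ _)
    exact measureReal_union_le _ _
  -- The five exceptional events leave probability at least 0.995.
  norm_num at b₁ b₂ b₃ b₄ b₅ ⊢
  linarith
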